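/- **Setting.** Let $1\le q\le p$. The cases $(X_i,\varepsilon_i)$, $i=1,2,\dots$, are i.i.d., where $X_i\in[0,1]^p$ has distribution $P$ and $\mathbb E\,\varepsilon_i^4<\infty$, and $Y_i=\beta_0+X_i^\top\beta+\varepsilon_i$. Fix $0\le\alpha\le1$, $0<\delta<1$, $0<\sigma_0<1$, $0<\eta\le1$ and $\lambda_0>0$. Assume that for every hyperrectangle $C\subseteq[0,1]^p$ (a product of intervals) with volume at least $\eta$ and $P(C)>0$ the smallest eigenvalue of the correlation matrix of $X$ given $X\in C$ is at least $2\lambda_0$ (in particular, the coordinates have positive variance given $X\in C$). **Random PILOT tree.** A tree is fitted to the first $n$ cases. At depth $0$ it consists of the root node (all cases, the cube $[0,1]^p$) with prediction $\bar Y$. In each of the following steps, for every current node $T$ with $t$ cases, a set $\mathcal S_T$ of $q$ predictors is drawn uniformly at random, independently of the data and of all other draws. The current residuals in $T$ are fitted by least squares with each of the following models: a constant (CON, $\nu=1$); for $j\in\mathcal S_T$ a line in predictor $j$ (LIN, $\nu=2$); and for $j\in\mathcal S_T$ and $s$ a value of predictor $j$ among the cases of $T$, a constant on each of $\{x_j\le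 s\}$ and $\{x_j>s\}$ (PCON, $\nu=5$), or a line in predictor $j$ on each of them (PLIN, $\nu=7$). The last two split the node into two child nodes, and are allowed only if the node and both child nodes satisfy the following: they have at least $n^\delta$ cases, the sample variance of every predictor in them is at least $2\sigma_0^2$, and the volume of their hyperrectangle is at least $\eta$. A model with the lowest value of $$\mathrm{BIC}_\alpha=t\log(\mathrm{RSS}/t)+(1+\alpha(\nu-1))\log t$$ is selected (with $\mathrm{BIC}_\alpha=-\infty$ if $\mathrm{RSS}=0$, and ties broken by any fixed rule), and its residuals are passed on: to the two child nodes if the model splits the node, and otherwise to the same node, where fitting continues in the next step. The prediction function is the sum of the fits along the path of a point. Let $L^k_n$ be the mean squared training error of the tree of depth $k$, that is, after $k$ steps, let $L^*_n$ be the mean squared training error of least squares regression of $Y$ on $X$ with intercept on the same $n$ cases, and let $\Xi$ denote the random draws of predictors. **Theorem.** There is a constant $c$ that does not depend on $n$, on $K$ or on the tie-breaking rule such that for all $n\ge2$ and all $K\ge0$ the expectation on the left exists and $$\mathbb E_{X,\varepsilon,\Xi}\big[L^K_n-L^*_n\big]\;\le\;\gamma^K\sqrt{\mathbb E_{X,\varepsilon,\Xi}\big[(L^0_n-L^*_n)^2\big]}\;+\;c\,\frac{\log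 n}{n^{\delta}},\qquad \gamma:=1-\frac{q\lambda_0}{4p^2}.$$ -/

import Mathlib

open MeasureTheory ProbabilityTheory
open scoped Classical

noncomputable section

namespace Pilot

/-- Average of `f` over the cases in `A`. -/
def avg {n : ℕ} (A : Finset (Fin n)) (f : Fin n → ℝ) : ℝ :=
  (∑ i ∈ A, f i) / (A.card : ℝ)

/-- Empirical covariance over the cases in `A` (with denominator the number of cases). -/
def scov {n : ℕ} (A : Finset (Fin n)) (f g : Fin n → ℝ) : ℝ :=
  avg A (fun i => (f i - avg A f) * (g i - avg A g))

/-- Simple least squares line of the response `r` on the regressor `x`, fitted on the cases in `A`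
and evaluated at `u`. If `x` is constant on `A`, this is the average of `r`. -/
def lsLine {n : ℕ} (A : Finset (Fin n)) (x r : Fin n → ℝ) (u : ℝ) : ℝ :=
  avg A r + scov A x r / scov A x x * (u - avg A x)

/-- Tuning constants of a random PILOT tree: `α` scales the degrees of freedom in the BIC; a node
must keep at least `n ^ δ` cases, a variance of at least `2 * σ₀ ^ 2` for every predictor,
and a volume of at least `η`. -/
structure Tuning where
  α : ℝ
  δ : ℝ
  σ₀ : ℝ
  η : ℝ

/-- A tree node: the cases it contains and the lower and upper ends of the sides of its
hyperrectangle. -/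
structure Node (n p : ℕ) where
  cases : Finset (Fin n)
  lo : Fin p → ℝ
  hi : Fin p → ℝ

namespace Node

variable {n p : ℕ}

/-- The root: all cases, and the unit cube. -/
def root (n p : ℕ) : Node n p := ⟨Finset.univ, fun _ => 0, fun _ => 1⟩

/-- The part of the node where predictor `j` is at most `s`. -/
def left (X : Fin n → Fin p → ℝ) (T : Node n p) (j : Fin p) (s : ℝ) : Node n p :=
  ⟨T.cases.filter (fun i => X i j ≤ s), T.lo, Function.update T.hi j s⟩

/-- The part of the node where predictor `j` exceeds `s`. -/
def right (X : Fin n → Fin p → ℝ) (T : Node n p) (j : Fin p) (s : ℝ) : Node n p :=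
  ⟨T.cases.filter (fun i => s < X i j), Function.update T.lo j s, T.hi⟩

/-- Volume of the hyperrectangle of the node. -/
def vol (T : Node n p) : ℝ := ∏ j, (T.hi j - T.lo j)

/-- The node is large enough in number of cases, predictor variances and volume. -/
def Large (θ : Tuning) (X : Fin n → Fin p → ℝ) (T : Node n p) : Prop :=
  (n : ℝ) ^ θ.δ ≤ (T.cases.card : ℝ) ∧
  (∀ j, 2 * θ.σ₀ ^ 2 ≤ scov T.cases (fun i => X i j) (fun i => X i j)) ∧
  θ.η ≤ T.vol

end Node

/-- The candidate models in a node: constant, linear in predictor `j`, and piecewise constant or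
piecewise linear in predictor `j` with the value of predictor `j` in case `i` as split point. -/
inductive Model (n p : ℕ) where
  | con : Model n p
  | lin (j : Fin p) : Model n p
  | pcon (j : Fin p) (i : Fin n) : Model n p
  | plin (j : Fin p) (i : Fin n) : Model n p

namespace Model

variable {n p : ℕ}

/-- Degrees of freedom of the model types. -/
def dof : Model n p → ℝ
  | con => 1
  | lin _ => 2
  | pcon _ _ => 5
  | plin _ _ => 7

/-- The least squares fit of the model on the node `T`, with `r` as response. -/
def fit (X : Fin n → Fin p → ℝ) (T : Node n p) (r : Fin n → ℝ) :
    Model n p → (Fin p → ℝ) → ℝ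
  | con => fun _ => avg T.cases r
  | lin j => fun x => lsLine T.cases (fun i => X i j) r (x j)
  | pcon j i => fun x =>
      if x j ≤ X i j then avg (T.left X j (X i j)).cases r
      else avg (T.right X j (X i j)).cases r
  | plin j i => fun x =>
      if x j ≤ X i j then lsLine (T.left X j (X i j)).cases (fun i => X i j) r (x j)
      else lsLine (T.right X j (X i j)).cases (fun i => X i j) r (x j)

/-- Residual sum of squares of the fitted model on the node. -/
def rss (X : Fin n → Fin p → ℝ) (T : Node n p) (r : Fin n → ℝ) (m : Model n p) : ℝ :=
  ∑ i ∈ T.cases, (r i - m.fit X T r (X i)) ^ 2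

/-- The criterion `t log (RSS / t) + ν_α log t`, with `ν_α = 1 + α (ν - 1)` and `t` the number of
cases in the node; it equals `-∞` for a perfect fit. -/
def bic (α : ℝ) (X : Fin n → Fin p → ℝ) (T : Node n p) (r : Fin n → ℝ) (m : Model n p) : EReal :=
  if m.rss X T r = 0 then ⊥
  else (((T.cases.card : ℝ) * Real.log (m.rss X T r / (T.cases.card : ℝ))
    + (1 + α * (m.dof - 1)) * Real.log (T.cases.card : ℝ) : ℝ) : EReal)

/-- The models that may be considered in the node when the predictors in `S` are drawn. A split
is only made if the node and both of the resulting nodes are large enough. -/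
def Allowed (θ : Tuning) (X : Fin n → Fin p → ℝ) (S : Finset (Fin p)) (T : Node n p) :
    Model n p → Prop
  | con => True
  | lin j => j ∈ S
  | pcon j i | plin j i => j ∈ S ∧ i ∈ T.cases ∧ T.Large θ X ∧
      (T.left X j (X i j)).Large θ X ∧ (T.right X j (X i j)).Large θ X

/-- The allowed models with the lowest criterion value. -/
def best (θ : Tuning) (X : Fin n → Fin p → ℝ) (S : Finset (Fin p)) (T : Node n p)
    (r : Fin n → ℝ) : Set (Model n p) :=
  {m | m.Allowed θ X S T ∧ ∀ m' : Model n p, m'.Allowed θ X S T →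
    m.bic θ.α X T r ≤ m'.bic θ.α X T r}

end Model

/-- The random draws of predictors used by a tree of depth `K`: a full binary tree of depth `K`
that carries a set of `q` predictors at every possible node of depth less than `K`. -/
def Draw (p q : ℕ) : ℕ → Type
  | 0 => Unit
  | K + 1 => {S : Finset (Fin p) // S.card = q} × Draw p q K × Draw p q K

instance Draw.instFintype (p q : ℕ) : (K : ℕ) → Fintype (Draw p q K)
  | 0 => inferInstanceAs (Fintype Unit)
  | K + 1 =>
    let _ := Draw.instFintype p q K
    inferInstanceAs (Fintype ({S : Finset (Fin p) // S.card = q} × Draw p q K × Draw p q K))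

/-- Expectation over uniformly distributed draws: the sets of predictors in different nodes are
independent, each uniformly distributed over the sets of `q` predictors. -/
def drawMean {p q K : ℕ} (f : Draw p q K → ℝ) : ℝ :=
  (∑ d, f d) / (Fintype.card (Draw p q K) : ℝ)

/-- What `K` further fitting steps add to the prediction in node `T`, with `r` the current
residuals. Every step selects a best model (`pick` breaks ties), fits it to the residuals and
passes the new residuals on, to both children if the model splits the node and to the same node
otherwise. -/
def grow {n p q : ℕ} (θ : Tuning) (pick : Set (Model n p) → Model n p)
    (X : Fin n → Fin p → ℝ) :
    (K : ℕ) → Node n p → (Fin n → ℝ) → Draw p q K → (Fin p → ℝ) → ℝ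
  | 0, _, _, _ => fun _ => 0
  | K + 1, T, r, (S, dl, dr) =>
    let m := pick (Model.best θ X S.1 T r)
    let g := m.fit X T r
    let r' : Fin n → ℝ := fun i => r i - g (X i)
    match m with
    | .con | .lin _ => fun x => g x + grow θ pick X K T r' dl x
    | .pcon j i | .plin j i => fun x => g x +
        if x j ≤ X i j then grow θ pick X K (T.left X j (X i j)) r' dl x
        else grow θ pick X K (T.right X j (X i j)) r' dr x

/-- Prediction function of the random PILOT tree of depth `K`. The tree of depth `0` is the root
with a constant fit. -/
def predict {n p q : ℕ} (θ : Tuning) (pick : Set (Model n p) → Model n p)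
    (X : Fin n → Fin p → ℝ) (Y : Fin n → ℝ) (K : ℕ) (d : Draw p q K) (x : Fin p → ℝ) : ℝ :=
  avg Finset.univ Y +
    grow θ pick X K (Node.root n p) (fun i => Y i - avg Finset.univ Y) d x

/-- Training loss of the random PILOT tree of depth `K`. -/
def treeLoss {n p q : ℕ} (θ : Tuning) (pick : Set (Model n p) → Model n p)
    (X : Fin n → Fin p → ℝ) (Y : Fin n → ℝ) (K : ℕ) (d : Draw p q K) : ℝ :=
  avg Finset.univ (fun i => (Y i - predict θ pick X Y K d (X i)) ^ 2)

/-- Training loss of least squares linear regression, with intercept. -/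
def lsLoss {n p : ℕ} (X : Fin n → Fin p → ℝ) (Y : Fin n → ℝ) : ℝ :=
  ⨅ b : ℝ × (Fin p → ℝ), avg Finset.univ (fun i => (Y i - (b.1 + ∑ j, b.2 j * X i j)) ^ 2)

/-- Correlation matrix of a distribution. If some coordinate has variance zero, the corresponding
diagonal entry is `0`, so that the smallest eigenvalue is then not positive. -/
def corMatrix {p : ℕ} (ν : Measure (Fin p → ℝ)) : Matrix (Fin p) (Fin p) ℝ :=
  Matrix.of fun j k =>
    cov[fun x => x j, fun x => x k; ν] /
      (√(Var[fun x => x j; ν]) * √(Var[fun x => x k; ν]))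

/-- For every hyperrectangle `C` in the unit cube with volume down to `η` and positive probability,
all eigenvalues of the correlation matrix of `X` given `X ∈ C` are at least `2 * l`. -/
def CorBounded {p : ℕ} (P : Measure (Fin p → ℝ)) (η l : ℝ) : Prop :=
  ∀ I : Fin p → Set ℝ, (∀ j, (I j).OrdConnected) →
    Set.univ.pi I ⊆ Set.Icc (0 : Fin p → ℝ) 1 →
    η ≤ (volume : Measure (Fin p → ℝ)).real (Set.univ.pi I) →
    P (Set.univ.pi I) ≠ 0 →
    (corMatrix (P[|Set.univ.pi I]) - (2 * l) • (1 : Matrix (Fin p) (Fin p) ℝ)).PosSemidef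

end Pilot

end

/-!
The proof compares the tree with an arbitrary affine function `ℓ` of the predictors and minimizes
over `ℓ` only at the end.

*One step in one node.* Within a node every fit so far is affine in the predictors, so the current
residual `r` and `z = Y - ℓ(X)` differ there by an affine function `b₀ + ∑ j, b j * x j`. Completing
the square in every `b j` shows that, if the sample correlation matrix in the node has no eigenvalue
below `κ`, the simple regressions of `r` on single predictors together reduce the residual sum of
squares by at least `κ * (∑ r ^ 2 - ∑ z ^ 2)` (`sum_sq_sub_le_sum_gain`). A predictor is drawn with
probability `q / p`, so the drawn predictors find a fraction `1 / p` of this total on average. The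
model with the best criterion value is at most a factor `exp (log t / t)` worse than any drawn line
(`Model.rss_le_of_bic_le`), since no model has fewer degrees of freedom than the constant, which has
one fewer than a line.

*All steps.* Sums of `z ^ 2`, unlike best affine fits, are additive over the children of a node.
Hence the bound for a single step passes through the recursion that defines the tree and gives a
geometric rate, with an accumulated tolerance of order `log n / n ^ δ`
(`drawMean_sse_sub_le`, `drawMean_treeLoss_sub_le`).

*Typical samples.* The bounds of a node are values of the predictors in at most `2 * p` cases. Given
these cases the hyperrectangle `C` is fixed and the other cases are still independent. For a function
`f` with mean `m` given `C` and values in the unit interval, the variable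
`exp (∑ i, (t * (f (X i) - m) - t ^ 2) * 1_C (X i))` has expectation at most `1`, whatever the number
of cases in `C`. By Markov's inequality, the first and second sample moments in a node with at least
`n ^ δ` cases are thus uniformly close to the conditional moments, except with a probability that is
exponentially small in `n ^ δ`, even after a union bound over the polynomially many choices of cases
(`measure_not_uniformlyClose_le`). Since the sample variances in a node are bounded below, half of
the eigenvalue bound survives (`wellConditioned_of_close`, `wellConditioned_of_reached`).

*Atypical samples.* No step increases the training error, so on the exceptional event the excess loss
is at most the mean square of the responses, whose square is integrable by the fourth moment
condition (`integral_le_of_bound_off`).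
-/

namespace Pilot

/-! ### Empirical moments and simple least squares -/

section Empirical

variable {n : ℕ} {A : Finset (Fin n)}

theorem card_mul_avg (A : Finset (Fin n)) (f : Fin n → ℝ) :
    (A.card : ℝ) * avg A f = ∑ i ∈ A, f i := by
  rcases A.eq_empty_or_nonempty with rfl | h
  · simp
  · have : (A.card : ℝ) ≠ 0 := by exact_mod_cast h.card_pos.ne'
    rw [avg]; field_simp

theorem card_mul_scov (A : Finset (Fin n)) (f g : Fin n → ℝ) :
    (A.card : ℝ) * scov A f g = ∑ i ∈ A, f i * g i - A.card * (avg A f * avg A g) := by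
  rw [scov, card_mul_avg]
  have h1 := card_mul_avg A f
  have h2 := card_mul_avg A g
  have : ∀ i, (f i - avg A f) * (g i - avg A g)
      = f i * g i - avg A f * g i - avg A g * f i + avg A f * avg A g := fun i => by ring
  simp only [this, Finset.sum_add_distrib, Finset.sum_sub_distrib, ← Finset.mul_sum,
    Finset.sum_const, nsmul_eq_mul, ← h1, ← h2]
  ring

theorem scov_eq (hA : A.Nonempty) (f g : Fin n → ℝ) :
    scov A f g = avg A (fun i => f i * g i) - avg A f * avg A g := by
  have h : (A.card : ℝ) ≠ 0 := by exact_mod_cast hA.card_pos.ne'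
  have h1 := card_mul_scov A f g
  rw [← card_mul_avg A (fun i => f i * g i), ← mul_sub] at h1
  exact mul_left_cancel₀ h h1

theorem scov_self_nonneg (A : Finset (Fin n)) (f : Fin n → ℝ) : 0 ≤ scov A f f :=
  div_nonneg (Finset.sum_nonneg fun _ _ => mul_self_nonneg _) (Nat.cast_nonneg _)

theorem sum_sub_avg_sq (A : Finset (Fin n)) (r : Fin n → ℝ) :
    ∑ i ∈ A, (r i - avg A r) ^ 2 = ∑ i ∈ A, r i ^ 2 - A.card * avg A r ^ 2 := by
  have h1 := card_mul_avg A r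
  have : ∀ i, (r i - avg A r) ^ 2 = r i ^ 2 - 2 * avg A r * r i + avg A r ^ 2 :=
    fun i => by ring
  simp only [this, Finset.sum_add_distrib, Finset.sum_sub_distrib, ← Finset.mul_sum,
    Finset.sum_const, nsmul_eq_mul, ← h1]
  ring

/-- The reduction of the residual sum of squares by a simple linear regression. The identity also
holds for a constant regressor, where the quotient is `0`. -/
theorem sum_sub_lsLine_sq (A : Finset (Fin n)) (x r : Fin n → ℝ) :
    ∑ i ∈ A, (r i - lsLine A x r (x i)) ^ 2
      = ∑ i ∈ A, r i ^ 2 - A.card * (avg A r ^ 2 + scov A x r ^ 2 / scov A x x) := by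
  have hr := sum_sub_avg_sq A r
  have hxr : ∑ i ∈ A, (x i - avg A x) * (r i - avg A r) = A.card * scov A x r := by
    rw [scov, card_mul_avg]
  have hxx : ∑ i ∈ A, (x i - avg A x) * (x i - avg A x) = A.card * scov A x x := by
    rw [scov, card_mul_avg]
  have : ∀ i, (r i - lsLine A x r (x i)) ^ 2 = (r i - avg A r) ^ 2
      - 2 * (scov A x r / scov A x x) * ((x i - avg A x) * (r i - avg A r))
      + (scov A x r / scov A x x) ^ 2 * ((x i - avg A x) * (x i - avg A x)) :=
    fun i => by rw [lsLine]; ring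
  simp only [this, Finset.sum_add_distrib, Finset.sum_sub_distrib, ← Finset.mul_sum, hr, hxr, hxx]
  by_cases h : scov A x x = 0
  · simp [h]
  · field_simp
    ring

theorem sum_sub_avg_sq_le (A : Finset (Fin n)) (r : Fin n → ℝ) :
    ∑ i ∈ A, (r i - avg A r) ^ 2 ≤ ∑ i ∈ A, r i ^ 2 := by
  rw [sum_sub_avg_sq]
  have : 0 ≤ (A.card : ℝ) * avg A r ^ 2 := by positivity
  linarith

theorem sum_sub_lsLine_sq_le (A : Finset (Fin n)) (x r : Fin n → ℝ) :
    ∑ i ∈ A, (r i - lsLine A x r (x i)) ^ 2 ≤ ∑ i ∈ A, r i ^ 2 := by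
  rw [sum_sub_lsLine_sq]
  have : 0 ≤ (A.card : ℝ) * (avg A r ^ 2 + scov A x r ^ 2 / scov A x x) :=
    mul_nonneg (Nat.cast_nonneg _)
      (add_nonneg (sq_nonneg _) (div_nonneg (sq_nonneg _) (scov_self_nonneg _ _)))
  linarith

theorem avg_add (A : Finset (Fin n)) (f g : Fin n → ℝ) :
    avg A (fun i => f i + g i) = avg A f + avg A g := by
  simp only [avg, Finset.sum_add_distrib, add_div]

theorem avg_mul_left (A : Finset (Fin n)) (c : ℝ) (f : Fin n → ℝ) :
    avg A (fun i => c * f i) = c * avg A f := by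
  simp only [avg, ← Finset.mul_sum, mul_div_assoc]

theorem avg_const (hA : A.Nonempty) (c : ℝ) : avg A (fun _ => c) = c := by
  have h : (A.card : ℝ) ≠ 0 := by exact_mod_cast hA.card_pos.ne'
  rw [avg]; simp [h]

theorem avg_finset_sum {ι : Type*} (s : Finset ι) (A : Finset (Fin n)) (f : ι → Fin n → ℝ) :
    avg A (fun i => ∑ j ∈ s, f j i) = ∑ j ∈ s, avg A (f j) := by
  simp only [avg, Finset.sum_div]
  rw [Finset.sum_comm]

theorem avg_nonneg {f : Fin n → ℝ} (h : ∀ i ∈ A, 0 ≤ f i) : 0 ≤ avg A f :=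
  div_nonneg (Finset.sum_nonneg h) (Nat.cast_nonneg _)

theorem avg_le_avg {f g : Fin n → ℝ} (h : ∀ i ∈ A, f i ≤ g i) : avg A f ≤ avg A g :=
  div_le_div_of_nonneg_right (Finset.sum_le_sum h) (Nat.cast_nonneg _)

/-- The correlation matrix of the regressors `x j` on the cases in `A` has no eigenvalue below `κ`,
stated for the covariances so that no regressor has to be rescaled. -/
def WellConditioned {p : ℕ} (A : Finset (Fin n)) (x : Fin p → Fin n → ℝ) (κ : ℝ) : Prop :=
  (∀ j, 0 < scov A (x j) (x j)) ∧ ∀ b : Fin p → ℝ,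
    κ * ∑ j, b j ^ 2 * scov A (x j) (x j) ≤ ∑ j, ∑ k, b j * b k * scov A (x j) (x k)

/-- If the regressors are well conditioned, the simple regressions together recover a fixed
proportion of what any affine function `b₀ + ∑ j, b j * x j` can explain. -/
theorem sum_sq_sub_le_sum_gain {p : ℕ} (hp : 1 ≤ p) {x : Fin p → Fin n → ℝ} {κ : ℝ}
    (hκ : 0 < κ) (hκ1 : κ ≤ 1) (h : WellConditioned A x κ)
    (r z : Fin n → ℝ) (b₀ : ℝ) (b : Fin p → ℝ)
    (hz : ∀ i ∈ A, r i - z i = b₀ + ∑ j, b j * x j i) :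
    κ * (∑ i ∈ A, r i ^ 2 - ∑ i ∈ A, z i ^ 2)
      ≤ ∑ j, (A.card : ℝ) * (avg A r ^ 2 + scov A (x j) r ^ 2 / scov A (x j) (x j)) := by
  rcases A.eq_empty_or_nonempty with rfl | hA
  · simp
  set g : Fin n → ℝ := fun i => b₀ + ∑ j, b j * x j i with hg
  have ht : (0 : ℝ) < A.card := by exact_mod_cast hA.card_pos
  have hD : ∑ i ∈ A, r i ^ 2 - ∑ i ∈ A, z i ^ 2
      = A.card * (2 * avg A (fun i => r i * g i) - avg A (fun i => g i * g i)) := by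
    rw [mul_sub, mul_left_comm, card_mul_avg, card_mul_avg, Finset.mul_sum,
      ← Finset.sum_sub_distrib, ← Finset.sum_sub_distrib]
    refine Finset.sum_congr rfl fun i hi => ?_
    have : z i = r i - g i := by rw [hg]; linarith [hz i hi]
    rw [this]; ring
  have hcov : ∀ f : Fin n → ℝ, scov A f g = ∑ j, b j * scov A f (x j) := by
    intro f
    rw [scov_eq hA]
    have h1 : (fun i => f i * g i) = fun i => b₀ * f i + ∑ j, b j * (f i * x j i) := by
      funext i; rw [hg]; simp only [mul_add, Finset.mul_sum]
      congr 1
      · ring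
      · exact Finset.sum_congr rfl fun j _ => by ring
    have h2 : avg A g = b₀ + ∑ j, b j * avg A (x j) := by
      rw [hg, avg_add, avg_const hA, avg_finset_sum]
      simp only [avg_mul_left]
    rw [h1, avg_add, avg_mul_left, avg_finset_sum, h2]
    simp only [avg_mul_left, scov_eq hA, mul_sub, mul_add, Finset.sum_sub_distrib, Finset.mul_sum]
    have : ∑ j, avg A f * (b j * avg A (x j)) = ∑ j, b j * (avg A f * avg A (x j)) :=
      Finset.sum_congr rfl fun j _ => by ring
    rw [this]; ring
  have hcomm : ∀ f g : Fin n → ℝ, scov A f g = scov A g f := fun f g => by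
    simp only [scov, mul_comm]
  have hrg : avg A (fun i => r i * g i) = ∑ j, b j * scov A (x j) r + avg A r * avg A g := by
    have := scov_eq hA r g
    rw [hcov r] at this
    simp only [hcomm (x _) r]
    linarith
  have hgg : avg A (fun i => g i * g i)
      = ∑ j, ∑ k, b j * b k * scov A (x j) (x k) + avg A g ^ 2 := by
    have := scov_eq hA g g
    rw [hcov g] at this
    have h3 : ∑ j, b j * scov A g (x j) = ∑ j, ∑ k, b j * b k * scov A (x j) (x k) := by
      refine Finset.sum_congr rfl fun j _ => ?_
      rw [hcomm, hcov, Finset.mul_sum]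
      exact Finset.sum_congr rfl fun k _ => by ring
    rw [h3] at this
    nlinarith
  -- completing the square in every coefficient
  have hterm : ∀ j, κ * (2 * (b j * scov A (x j) r)) - κ * (κ * (b j ^ 2 * scov A (x j) (x j)))
      ≤ scov A (x j) r ^ 2 / scov A (x j) (x j) := by
    intro j
    rw [le_div_iff₀ (h.1 j)]
    nlinarith [sq_nonneg (scov A (x j) r - κ * (b j * scov A (x j) (x j)))]
  have hsum := Finset.sum_le_sum fun j (_ : j ∈ Finset.univ) => hterm j
  rw [Finset.sum_sub_distrib, ← Finset.mul_sum, ← Finset.mul_sum, ← Finset.mul_sum,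
    ← Finset.mul_sum] at hsum
  have hwc := h.2 b
  have hp' : (1 : ℝ) ≤ p := by exact_mod_cast hp
  rw [hD, ← Finset.mul_sum, Finset.sum_add_distrib, Finset.sum_const, Finset.card_univ,
    Fintype.card_fin, nsmul_eq_mul, mul_left_comm]
  refine mul_le_mul_of_nonneg_left ?_ ht.le
  rw [hrg, hgg]
  have h4 : κ * (2 * (avg A r * avg A g) - avg A g ^ 2) ≤ p * avg A r ^ 2 := by
    have : κ * (2 * (avg A r * avg A g) - avg A g ^ 2) ≤ κ * avg A r ^ 2 :=
      mul_le_mul_of_nonneg_left (by nlinarith [sq_nonneg (avg A r - avg A g)]) hκ.le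
    nlinarith [sq_nonneg (avg A r)]
  have h5 := mul_le_mul_of_nonneg_left hwc hκ.le
  nlinarith

end Empirical

/-! ### Model selection in a node -/

section Selection

variable {n p : ℕ} {X : Fin n → Fin p → ℝ} {T : Node n p} {r : Fin n → ℝ}

instance : Finite (Model n p) := by
  have h : (Set.univ : Set (Model n p)) ⊆ {Model.con} ∪ Set.range Model.lin
      ∪ Set.range (fun a : Fin p × Fin n => Model.pcon a.1 a.2)
      ∪ Set.range (fun a : Fin p × Fin n => Model.plin a.1 a.2) := by
    rintro (_ | j | ⟨j, i⟩ | ⟨j, i⟩) _ <;> simp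
  exact Set.finite_univ_iff.1 (Set.Finite.subset (by
    refine (((Set.finite_singleton _).union (Set.finite_range _)).union
      (Set.finite_range _)).union (Set.finite_range _)) h)

theorem Node.sum_left_add_sum_right (X : Fin n → Fin p → ℝ) (T : Node n p) (j : Fin p) (s : ℝ)
    (f : Fin n → ℝ) :
    ∑ i ∈ (T.left X j s).cases, f i + ∑ i ∈ (T.right X j s).cases, f i = ∑ i ∈ T.cases, f i := by
  rw [← Finset.sum_filter_add_sum_filter_not T.cases (fun i => X i j ≤ s)]
  simp only [Node.left, Node.right, not_le]

theorem Model.rss_nonneg (m : Model n p) : 0 ≤ m.rss X T r :=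
  Finset.sum_nonneg fun _ _ => sq_nonneg _

/-- Sums over a node, evaluated separately in the two children. -/
theorem Node.sum_ite (X : Fin n → Fin p → ℝ) (T : Node n p) (j : Fin p) (s : ℝ)
    (f g : Fin n → ℝ) :
    ∑ i ∈ T.cases, (if X i j ≤ s then f i else g i)
      = ∑ i ∈ (T.left X j s).cases, f i + ∑ i ∈ (T.right X j s).cases, g i := by
  rw [← Node.sum_left_add_sum_right X T j s]
  congr 1
  · refine Finset.sum_congr rfl fun i hi => if_pos ?_
    exact (Finset.mem_filter.1 hi).2
  · refine Finset.sum_congr rfl fun i hi => if_neg ?_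
    exact not_le.2 (Finset.mem_filter.1 hi).2

/-- Every model contains the zero function. -/
theorem Model.rss_le (m : Model n p) : m.rss X T r ≤ ∑ i ∈ T.cases, r i ^ 2 := by
  rcases m with _ | j | ⟨j, i₀⟩ | ⟨j, i₀⟩
  · exact sum_sub_avg_sq_le _ _
  · exact sum_sub_lsLine_sq_le T.cases (fun i => X i j) r
  · have h : Model.rss X T r (.pcon j i₀) = ∑ i ∈ T.cases, (if X i j ≤ X i₀ j
        then (r i - avg (T.left X j (X i₀ j)).cases r) ^ 2
        else (r i - avg (T.right X j (X i₀ j)).cases r) ^ 2) := by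
      refine Finset.sum_congr rfl fun i _ => ?_
      simp only [Model.fit]; split_ifs <;> rfl
    rw [h, Node.sum_ite, ← Node.sum_left_add_sum_right X T j (X i₀ j)]
    exact add_le_add (sum_sub_avg_sq_le _ _) (sum_sub_avg_sq_le _ _)
  · have h : Model.rss X T r (.plin j i₀) = ∑ i ∈ T.cases, (if X i j ≤ X i₀ j
        then (r i - lsLine (T.left X j (X i₀ j)).cases (fun i => X i j) r (X i j)) ^ 2
        else (r i - lsLine (T.right X j (X i₀ j)).cases (fun i => X i j) r (X i j)) ^ 2) := by
      refine Finset.sum_congr rfl fun i _ => ?_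
      simp only [Model.fit]; split_ifs <;> rfl
    rw [h, Node.sum_ite, ← Node.sum_left_add_sum_right X T j (X i₀ j)]
    exact add_le_add (sum_sub_lsLine_sq_le _ _ _) (sum_sub_lsLine_sq_le _ _ _)

theorem Model.rss_lin (j : Fin p) :
    Model.rss X T r (.lin j) = ∑ i ∈ T.cases, r i ^ 2 - T.cases.card * (avg T.cases r ^ 2
      + scov T.cases (fun i => X i j) r ^ 2 / scov T.cases (fun i => X i j) (fun i => X i j)) :=
  sum_sub_lsLine_sq T.cases (fun i => X i j) r

theorem Model.best_nonempty (θ : Tuning) (S : Finset (Fin p)) :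
    (Model.best θ X S T r).Nonempty := by
  obtain ⟨m, hm, hmin⟩ := Set.exists_min_image {m : Model n p | m.Allowed θ X S T}
    (fun m => m.bic θ.α X T r) (Set.toFinite _) ⟨.con, trivial⟩
  exact ⟨m, hm, hmin⟩

theorem Model.one_le_dof (m : Model n p) : 1 ≤ m.dof := by
  cases m <;> simp [Model.dof]

/-- A model with a criterion value at most that of a line fits almost as well as the line. -/
theorem Model.rss_le_of_bic_le {α : ℝ} (hα₀ : 0 ≤ α) (hα₁ : α ≤ 1) (hT : T.cases.Nonempty)
    {m : Model n p} {j : Fin p} (h : m.bic α X T r ≤ (Model.lin j).bic α X T r) :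
    m.rss X T r ≤ (1 + 2 * (Real.log T.cases.card / T.cases.card)) * (Model.lin j).rss X T r := by
  set t : ℝ := (T.cases.card : ℝ) with ht
  have ht1 : (1 : ℝ) ≤ t := by rw [ht]; exact_mod_cast hT.card_pos
  have hlog : 0 ≤ Real.log t := Real.log_nonneg ht1
  have hlt : 0 ≤ Real.log t / t := by positivity
  by_cases h0 : m.rss X T r = 0
  · rw [h0]; exact mul_nonneg (by positivity) (Model.rss_nonneg _)
  have hl0 : (Model.lin j).rss X T r ≠ 0 := by
    intro hl
    simp only [Model.bic, hl, h0, if_true, if_false] at h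
    exact absurd (le_bot_iff.1 h) (EReal.coe_ne_bot _)
  simp only [Model.bic, hl0, h0, if_false, EReal.coe_le_coe_iff, ← ht] at h
  have hmp : 0 < m.rss X T r := lt_of_le_of_ne (Model.rss_nonneg _) (Ne.symm h0)
  have hlp : 0 < (Model.lin j).rss X T r := lt_of_le_of_ne (Model.rss_nonneg _) (Ne.symm hl0)
  rw [Real.log_div h0 (by positivity), Real.log_div hl0 (by positivity)] at h
  have hd : (Model.lin j : Model n p).dof = 2 := rfl
  have hdm := m.one_le_dof
  have h1 : t * (Real.log (m.rss X T r) - Real.log ((Model.lin j).rss X T r)) ≤ Real.log t := by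
    have : α * (1 - (m.dof - 1)) * Real.log t ≤ 1 * Real.log t := by
      refine mul_le_mul_of_nonneg_right ?_ hlog
      nlinarith
    rw [hd] at h
    nlinarith
  have h2 : Real.log (m.rss X T r) ≤ Real.log t / t + Real.log ((Model.lin j).rss X T r) := by
    have : Real.log (m.rss X T r) - Real.log ((Model.lin j).rss X T r) ≤ Real.log t / t := by
      rw [le_div_iff₀ (by positivity)]; linarith
    linarith
  have h3 : m.rss X T r ≤ Real.exp (Real.log t / t) * (Model.lin j).rss X T r := by
    calc m.rss X T r = Real.exp (Real.log (m.rss X T r)) := (Real.exp_log hmp).symm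
      _ ≤ _ := Real.exp_le_exp.2 h2
      _ = _ := by rw [Real.exp_add, Real.exp_log hlp]
  refine h3.trans (mul_le_mul_of_nonneg_right ?_ hlp.le)
  have hle1 : Real.log t / t ≤ 1 := by
    rw [div_le_one (by positivity)]
    linarith [Real.log_le_sub_one_of_pos (by positivity : 0 < t)]
  have h4 := Real.abs_exp_sub_one_sub_id_le (x := Real.log t / t) (by rwa [abs_of_nonneg hlt])
  have h5 := (abs_le.1 h4).2
  nlinarith

end Selection

/-! ### Averages over the draws of predictors -/

section Draws

variable {p q : ℕ}

theorem card_sets_pos (hqp : q ≤ p) :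
    0 < Fintype.card {S : Finset (Fin p) // S.card = q} := by
  obtain ⟨S, -, hS⟩ := Finset.exists_subset_card_eq
    (s := (Finset.univ : Finset (Fin p))) (n := q) (by simpa using hqp)
  exact Fintype.card_pos_iff.2 ⟨⟨S, hS⟩⟩

theorem card_draw_pos (hqp : q ≤ p) : ∀ K, 0 < Fintype.card (Draw p q K)
  | 0 => Fintype.card_pos_iff.2 ⟨()⟩
  | K + 1 => by
    obtain ⟨S⟩ := Fintype.card_pos_iff.1 (card_sets_pos hqp)
    obtain ⟨d⟩ := Fintype.card_pos_iff.1 (card_draw_pos hqp K)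
    exact Fintype.card_pos_iff.2 ⟨(S, d, d)⟩

theorem drawMean_mono {K : ℕ} {f g : Draw p q K → ℝ} (h : ∀ d, f d ≤ g d) :
    drawMean f ≤ drawMean g :=
  div_le_div_of_nonneg_right (Finset.sum_le_sum fun d _ => h d) (Nat.cast_nonneg _)

theorem drawMean_const (hqp : q ≤ p) (K : ℕ) (c : ℝ) :
    drawMean (fun _ : Draw p q K => c) = c := by
  have : (Fintype.card (Draw p q K) : ℝ) ≠ 0 := by exact_mod_cast (card_draw_pos hqp K).ne'
  simp [drawMean, this]

theorem drawMean_add {K : ℕ} (f g : Draw p q K → ℝ) :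
    drawMean (fun d => f d + g d) = drawMean f + drawMean g := by
  simp only [drawMean, Finset.sum_add_distrib, add_div]

theorem drawMean_sub_const (hqp : q ≤ p) {K : ℕ} (f : Draw p q K → ℝ) (c : ℝ) :
    drawMean (fun d => f d - c) = drawMean f - c := by
  simp only [sub_eq_add_neg, drawMean_add, drawMean_const hqp]

theorem drawMean_div {K : ℕ} (f : Draw p q K → ℝ) (c : ℝ) :
    drawMean (fun d => f d / c) = drawMean f / c := by
  simp only [drawMean, ← Finset.sum_div, div_right_comm]

theorem drawMean_succ {K : ℕ} (f : Draw p q (K + 1) → ℝ) :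
    drawMean f = (∑ S, drawMean fun dl => drawMean fun dr => f (S, dl, dr))
      / (Fintype.card {S : Finset (Fin p) // S.card = q} : ℝ) := by
  have h1 : ∑ d, f d = ∑ S, ∑ dl : Draw p q K, ∑ dr : Draw p q K, f (S, dl, dr) := by
    simp only [← Fintype.sum_prod_type']
    rfl
  have h2 : Fintype.card (Draw p q (K + 1)) = Fintype.card {S : Finset (Fin p) // S.card = q}
      * (Fintype.card (Draw p q K) * Fintype.card (Draw p q K)) := by
    rw [← Fintype.card_prod, ← Fintype.card_prod]
    rfl
  simp only [drawMean, h1, h2, ← Finset.sum_div, Nat.cast_mul, div_div]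
  congr 1
  ring

/-- By symmetry, every predictor is drawn with probability `q / p`. -/
theorem sum_sum_mem_draw (f : Fin p → ℝ) :
    (p : ℝ) * ∑ S : {S : Finset (Fin p) // S.card = q}, ∑ j ∈ S.1, f j
      = q * Fintype.card {S : Finset (Fin p) // S.card = q} * ∑ j, f j := by
  set N : Fin p → ℝ := fun j =>
    ∑ S : {S : Finset (Fin p) // S.card = q}, if j ∈ S.1 then (1 : ℝ) else 0 with hN
  have hsym : ∀ j k, N j = N k := by
    intro j k
    refine Fintype.sum_equiv ((Equiv.swap j k).finsetCongr.subtypeEquiv fun S => by simp) _ _ ?_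
    rintro ⟨S, hS⟩
    simp [Equiv.finsetCongr]
  have hswap : ∀ g : Fin p → ℝ, ∑ S : {S : Finset (Fin p) // S.card = q}, ∑ j ∈ S.1, g j
      = ∑ j, N j * g j := by
    intro g
    simp only [hN, Finset.sum_mul]
    rw [Finset.sum_comm]
    refine Finset.sum_congr rfl fun S _ => ?_
    simp
  have hone := hswap fun _ => 1
  have hj : ∀ j, (p : ℝ) * N j = q * Fintype.card {S : Finset (Fin p) // S.card = q} := by
    intro j
    have h1 : ∑ S : {S : Finset (Fin p) // S.card = q}, ∑ j ∈ S.1, (1 : ℝ)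
        = q * Fintype.card {S : Finset (Fin p) // S.card = q} := by
      have : ∀ S : {S : Finset (Fin p) // S.card = q}, ∑ j ∈ S.1, (1 : ℝ) = q := by
        intro S; simp [S.2]
      simp [this, mul_comm]
    rw [h1] at hone
    rw [hone, Finset.sum_congr rfl fun k _ => by rw [hsym k j, mul_one]]
    simp
  rw [hswap, Finset.mul_sum, Finset.mul_sum]
  exact Finset.sum_congr rfl fun j _ => by rw [← mul_assoc, hj]

end Draws

/-! ### Contraction of the training error -/

section Contraction

variable {n p q : ℕ} {θ : Tuning} {X : Fin n → Fin p → ℝ}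

/-- The nodes that can occur in a tree: the root, and the large children of splits at a case of the
node. -/
inductive Reached (θ : Tuning) (X : Fin n → Fin p → ℝ) : Node n p → Prop
  | root : Reached θ X (Node.root n p)
  | left {T : Node n p} (hT : Reached θ X T) (j : Fin p) {i : Fin n} (hi : i ∈ T.cases)
      (hL : (T.left X j (X i j)).Large θ X) : Reached θ X (T.left X j (X i j))
  | right {T : Node n p} (hT : Reached θ X T) (j : Fin p) {i : Fin n} (hi : i ∈ T.cases)
      (hL : (T.right X j (X i j)).Large θ X) : Reached θ X (T.right X j (X i j))

/-- Sum of squared residuals in the node `T` after `K` further steps, started from the residuals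
`r`. -/
noncomputable def sse (θ : Tuning) (pick : Set (Model n p) → Model n p) (X : Fin n → Fin p → ℝ)
    (K : ℕ) (T : Node n p) (r : Fin n → ℝ) (d : Draw p q K) : ℝ :=
  ∑ i ∈ T.cases, (r i - grow θ pick X K T r d (X i)) ^ 2

variable {pick : Set (Model n p) → Model n p}

theorem sse_zero (T : Node n p) (r : Fin n → ℝ) (d : Draw p q 0) :
    sse θ pick X 0 T r d = ∑ i ∈ T.cases, r i ^ 2 := by
  simp [sse, grow]

/-- The residuals that the selected model leaves. -/
noncomputable def nextResid (θ : Tuning) (pick : Set (Model n p) → Model n p)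
    (X : Fin n → Fin p → ℝ) (S : Finset (Fin p)) (T : Node n p) (r : Fin n → ℝ) : Fin n → ℝ :=
  fun i => r i - (pick (Model.best θ X S T r)).fit X T r (X i)

theorem rss_pick (S : Finset (Fin p)) (T : Node n p) (r : Fin n → ℝ) :
    (pick (Model.best θ X S T r)).rss X T r
      = ∑ i ∈ T.cases, nextResid θ pick X S T r i ^ 2 := rfl

/-- A step either keeps the node and continues with its first subtree of draws, or splits it and
continues in both children. -/
theorem sse_succ {K : ℕ} (T : Node n p) (r : Fin n → ℝ)
    (S : {S : Finset (Fin p) // S.card = q}) :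
    ((∀ dl dr : Draw p q K, sse θ pick X (K + 1) T r (S, dl, dr)
        = sse θ pick X K T (nextResid θ pick X S.1 T r) dl) ∧
      (pick (Model.best θ X S.1 T r) = .con ∨ ∃ j, pick (Model.best θ X S.1 T r) = .lin j)) ∨
    ∃ j i, (∀ dl dr : Draw p q K, sse θ pick X (K + 1) T r (S, dl, dr)
        = sse θ pick X K (T.left X j (X i j)) (nextResid θ pick X S.1 T r) dl
          + sse θ pick X K (T.right X j (X i j)) (nextResid θ pick X S.1 T r) dr) ∧
      (pick (Model.best θ X S.1 T r) = .pcon j i ∨ pick (Model.best θ X S.1 T r) = .plin j i) := by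
  have hn : nextResid θ pick X S.1 T r
      = fun i => r i - (pick (Model.best θ X S.1 T r)).fit X T r (X i) := rfl
  rcases hm : pick (Model.best θ X S.1 T r) with _ | j | ⟨j, i⟩ | ⟨j, i⟩ <;> rw [hm] at hn
  · refine Or.inl ⟨fun dl dr => Finset.sum_congr rfl fun i _ => ?_, Or.inl rfl⟩
    simp only [grow, hm, hn]
    rw [sub_add_eq_sub_sub]
  · refine Or.inl ⟨fun dl dr => Finset.sum_congr rfl fun i _ => ?_, Or.inr ⟨j, rfl⟩⟩
    simp only [grow, hm, hn]
    rw [sub_add_eq_sub_sub]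
  all_goals
    refine Or.inr ⟨j, i, fun dl dr => ?_, by simp⟩
    simp only [sse]
    rw [← Node.sum_ite]
    refine Finset.sum_congr rfl fun k _ => ?_
    simp only [grow, hm, hn]
    split_ifs <;> rw [sub_add_eq_sub_sub]

/-- No step increases the training error. -/
theorem sse_le : ∀ (K : ℕ) (T : Node n p) (r : Fin n → ℝ) (d : Draw p q K),
    sse θ pick X K T r d ≤ ∑ i ∈ T.cases, r i ^ 2
  | 0, T, r, d => (sse_zero T r d).le
  | K + 1, T, r, (S, dl, dr) => by
    have hr : ∑ i ∈ T.cases, nextResid θ pick X S.1 T r i ^ 2 ≤ ∑ i ∈ T.cases, r i ^ 2 :=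
      Model.rss_le (pick (Model.best θ X S.1 T r))
    rcases sse_succ (θ := θ) (pick := pick) (X := X) (K := K) T r S with ⟨h, -⟩ | ⟨j, i, h, -⟩
    · rw [h]; exact (sse_le K _ _ _).trans hr
    · rw [h]
      refine le_trans (add_le_add (sse_le K _ _ _) (sse_le K _ _ _)) ?_
      rw [Node.sum_left_add_sum_right]; exact hr

/-- The current residuals `r` differ from `z` by an affine function of the predictors, within the
node. -/
def AffineOn (X : Fin n → Fin p → ℝ) (A : Finset (Fin n)) (r z : Fin n → ℝ) : Prop :=
  ∃ (b₀ : ℝ) (b : Fin p → ℝ), ∀ i ∈ A, r i - z i = b₀ + ∑ j, b j * X i j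

theorem AffineOn.sub_line {A B : Finset (Fin n)} {r z : Fin n → ℝ} (h : AffineOn X A r z)
    (hBA : B ⊆ A) {r' : Fin n → ℝ} (j : Fin p) (c d : ℝ)
    (hr : ∀ i ∈ B, r' i = r i - (c + d * X i j)) : AffineOn X B r' z := by
  obtain ⟨b₀, b, hb⟩ := h
  refine ⟨b₀ - c, fun k => b k - if k = j then d else 0, fun i hi => ?_⟩
  have : ∑ k, (b k - if k = j then d else 0) * X i k = ∑ k, b k * X i k - d * X i j := by
    simp [sub_mul, Finset.sum_sub_distrib, ite_mul]
  rw [this, hr i hi]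
  linarith [hb i (hBA hi)]

theorem AffineOn.sub_lsLine {A B : Finset (Fin n)} {r z : Fin n → ℝ} (h : AffineOn X A r z)
    (hBA : B ⊆ A) {r' : Fin n → ℝ} (j : Fin p) (C : Finset (Fin n)) (w : Fin n → ℝ)
    (hr : ∀ i ∈ B, r' i = r i - lsLine C (fun i => X i j) w (X i j)) : AffineOn X B r' z := by
  set s := scov C (fun i => X i j) w / scov C (fun i => X i j) (fun i => X i j)
  refine h.sub_line hBA j (avg C w - s * avg C fun i => X i j) s fun i hi => ?_
  rw [hr i hi, lsLine]; ring

variable {κ κ' e : ℝ}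

/-- One step, averaged over the drawn predictors. The drawn predictors find at least the average
of the gains of all simple regressions, up to the tolerance `e` of the criterion. -/
theorem mean_rss_pick_le (hp : 1 ≤ p) (hq : 1 ≤ q) (hqp : q ≤ p)
    (hpick : ∀ s : Set (Model n p), s.Nonempty → pick s ∈ s)
    (hα₀ : 0 ≤ θ.α) (hα₁ : θ.α ≤ 1) (hκ : 0 < κ) (hκ1 : κ ≤ 1) (hκ' : 0 ≤ κ') (hκκ : p * κ' ≤ κ)
    {T : Node n p} (hne : T.cases.Nonempty)
    (hwc : WellConditioned T.cases (fun j i => X i j) κ)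
    (he : 2 * (Real.log T.cases.card / T.cases.card) ≤ e) {r z : Fin n → ℝ}
    (hz : AffineOn X T.cases r z) :
    (∑ S : {S : Finset (Fin p) // S.card = q}, (pick (Model.best θ X S.1 T r)).rss X T r)
        / (Fintype.card {S : Finset (Fin p) // S.card = q} : ℝ) - ∑ i ∈ T.cases, z i ^ 2
      ≤ (1 - κ') * (∑ i ∈ T.cases, r i ^ 2 - ∑ i ∈ T.cases, z i ^ 2)
        + e * ∑ i ∈ T.cases, r i ^ 2 := by
  set R := ∑ i ∈ T.cases, r i ^ 2 with hR
  set Z := ∑ i ∈ T.cases, z i ^ 2 with hZ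
  set N : ℝ := (Fintype.card {S : Finset (Fin p) // S.card = q} : ℝ) with hNdef
  have hR0 : 0 ≤ R := Finset.sum_nonneg fun _ _ => sq_nonneg _
  have hN : 0 < N := Nat.cast_pos.2 (card_sets_pos hqp)
  have hp0 : (0 : ℝ) < p := by exact_mod_cast hp
  have hq0 : (0 : ℝ) < q := by exact_mod_cast hq
  have he0 : 0 ≤ e := le_trans (by
    have : (1 : ℝ) ≤ T.cases.card := by exact_mod_cast hne.card_pos
    have := Real.log_nonneg this
    positivity) he
  set gain : Fin p → ℝ := fun j => (T.cases.card : ℝ) * (avg T.cases r ^ 2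
    + scov T.cases (fun i => X i j) r ^ 2 / scov T.cases (fun i => X i j) (fun i => X i j))
    with hgain
  have hgain_sum : κ * (R - Z) ≤ ∑ j, gain j := by
    obtain ⟨b₀, b, hb⟩ := hz
    exact sum_sq_sub_le_sum_gain hp hκ hκ1 hwc r z b₀ b hb
  have hS : ∀ S : {S : Finset (Fin p) // S.card = q},
      q * (pick (Model.best θ X S.1 T r)).rss X T r
        ≤ q * (R + e * R) - ∑ j ∈ S.1, gain j := by
    intro S
    have hmem := hpick _ (Model.best_nonempty (X := X) (T := T) (r := r) θ S.1)
    have hj : ∀ j ∈ S.1, (pick (Model.best θ X S.1 T r)).rss X T r ≤ R + e * R - gain j := by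
      intro j hj
      have h1 := Model.rss_le_of_bic_le hα₀ hα₁ hne (hmem.2 (.lin j) hj)
      have h2 : Model.rss X T r (.lin j) ≤ R := Model.rss_le _
      have h3 : Model.rss X T r (.lin j) = R - gain j := Model.rss_lin j
      have h4 : 0 ≤ Model.rss X T r (.lin j) := Model.rss_nonneg _
      have h5 : 2 * (Real.log T.cases.card / T.cases.card) * Model.rss X T r (.lin j) ≤ e * R :=
        mul_le_mul he h2 h4 he0
      linarith
    have := Finset.sum_le_sum hj
    simp only [Finset.sum_sub_distrib, Finset.sum_const, S.2, nsmul_eq_mul] at this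
    exact this
  have hsum := Finset.sum_le_sum fun S (_ : S ∈ Finset.univ) => hS S
  have hle : ∀ S : {S : Finset (Fin p) // S.card = q},
      (pick (Model.best θ X S.1 T r)).rss X T r ≤ R := fun S => Model.rss_le _
  rw [← Finset.mul_sum, Finset.sum_sub_distrib, Finset.sum_const, Finset.card_univ, nsmul_eq_mul,
    ← hNdef] at hsum
  have hdraw := sum_sum_mem_draw (q := q) gain
  rw [← hNdef] at hdraw
  have hsum2 : ∑ S : {S : Finset (Fin p) // S.card = q},
      (pick (Model.best θ X S.1 T r)).rss X T r ≤ N * R := by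
    refine (Finset.sum_le_sum fun S _ => hle S).trans_eq ?_
    rw [Finset.sum_const, Finset.card_univ, nsmul_eq_mul]
  rw [sub_le_iff_le_add, div_le_iff₀ hN]
  by_cases hD : R - Z ≤ 0
  · have h1 : κ' * (R - Z) ≤ 0 := mul_nonpos_of_nonneg_of_nonpos hκ' hD
    nlinarith [mul_nonneg he0 hR0]
  · push Not at hD
    have h1 : p * κ' * (R - Z) ≤ ∑ j, gain j :=
      (mul_le_mul_of_nonneg_right hκκ hD.le).trans hgain_sum
    have h2 : q * N * (p * κ' * (R - Z)) ≤ q * N * ∑ j, gain j :=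
      mul_le_mul_of_nonneg_left h1 (by positivity)
    have h3 : (p * q : ℝ) * ∑ S : {S : Finset (Fin p) // S.card = q},
        (pick (Model.best θ X S.1 T r)).rss X T r
        ≤ (p * q : ℝ) * (((1 - κ') * (R - Z) + e * R + Z) * N) := by
      have := mul_le_mul_of_nonneg_left hsum hp0.le
      nlinarith
    exact le_of_mul_le_mul_left h3 (by positivity)

/-- The mean training error in a node approaches that of any affine function geometrically. The sum
of squares of `z`, in contrast to the best affine fit in the node, is additive over the children,
so that the bounds in the children add up. -/
theorem drawMean_sse_sub_le (hp : 1 ≤ p) (hq : 1 ≤ q) (hqp : q ≤ p)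
    (hpick : ∀ s : Set (Model n p), s.Nonempty → pick s ∈ s)
    (hα₀ : 0 ≤ θ.α) (hα₁ : θ.α ≤ 1) (hκ : 0 < κ) (hκ1 : κ ≤ 1) (hκ' : 0 ≤ κ')
    (hκ'1 : κ' ≤ 1) (hκκ : p * κ' ≤ κ) (he0 : 0 ≤ e)
    (hgood : ∀ T : Node n p, Reached θ X T → T.cases.Nonempty ∧
      WellConditioned T.cases (fun j i => X i j) κ ∧
      2 * (Real.log T.cases.card / T.cases.card) ≤ e) (z : Fin n → ℝ) :
    ∀ (K : ℕ) (T : Node n p) (_ : Reached θ X T) (r : Fin n → ℝ) (_ : AffineOn X T.cases r z),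
      drawMean (fun d : Draw p q K => sse θ pick X K T r d) - ∑ i ∈ T.cases, z i ^ 2
        ≤ (1 - κ') ^ K * (∑ i ∈ T.cases, r i ^ 2 - ∑ i ∈ T.cases, z i ^ 2)
          + e * (∑ k ∈ Finset.range K, (1 - κ') ^ k) * ∑ i ∈ T.cases, r i ^ 2
  | 0, T, hT, r, hr => by
    simp only [sse_zero, drawMean_const hqp]
    simp
  | K + 1, T, hT, r, hr => by
    have IH := drawMean_sse_sub_le hp hq hqp hpick hα₀ hα₁ hκ hκ1 hκ' hκ'1 hκκ he0 hgood z K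
    obtain ⟨hne, hwc, he⟩ := hgood T hT
    have hstep := mean_rss_pick_le (q := q) (θ := θ) hp hq hqp hpick hα₀ hα₁ hκ hκ1 hκ' hκκ
      hne hwc he hr
    set R := ∑ i ∈ T.cases, r i ^ 2 with hR
    set Z := ∑ i ∈ T.cases, z i ^ 2 with hZ
    set N : ℝ := (Fintype.card {S : Finset (Fin p) // S.card = q} : ℝ) with hNdef
    set s := ∑ k ∈ Finset.range K, (1 - κ') ^ k with hs
    have hs0 : 0 ≤ s := Finset.sum_nonneg fun k _ => pow_nonneg (by linarith) _
    have hpow : 0 ≤ (1 - κ') ^ K := pow_nonneg (by linarith) _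
    have hN : 0 < N := Nat.cast_pos.2 (card_sets_pos hqp)
    have hS : ∀ S : {S : Finset (Fin p) // S.card = q},
        (drawMean fun dl : Draw p q K => drawMean fun dr : Draw p q K =>
          sse θ pick X (K + 1) T r (S, dl, dr))
        ≤ (1 - κ') ^ K * ((pick (Model.best θ X S.1 T r)).rss X T r - Z) + e * s * R + Z := by
      intro S
      have hmem := hpick _ (Model.best_nonempty (X := X) (T := T) (r := r) θ S.1)
      have hle : ∑ i ∈ T.cases, nextResid θ pick X S.1 T r i ^ 2 ≤ R := Model.rss_le _
      have hle' := mul_le_mul_of_nonneg_left hle (mul_nonneg he0 hs0)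
      rw [rss_pick]
      rcases sse_succ (θ := θ) (pick := pick) (X := X) (K := K) T r S with
        ⟨h, hm⟩ | ⟨j, i, h, hm⟩
      · simp only [h, drawMean_const hqp]
        have haff : AffineOn X T.cases (nextResid θ pick X S.1 T r) z := by
          rcases hm with hm | ⟨j, hm⟩
          · refine hr.sub_line subset_rfl ⟨0, hp⟩ (avg T.cases r) 0 fun i _ => ?_
            simp [nextResid, hm, Model.fit]
          · refine hr.sub_lsLine subset_rfl j T.cases r fun i _ => ?_
            simp only [nextResid, hm, Model.fit]
        have := IH T hT _ haff
        linarith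
      · have hall : i ∈ T.cases ∧ (T.left X j (X i j)).Large θ X ∧
            (T.right X j (X i j)).Large θ X := by
          have := hmem.1
          rcases hm with hm | hm <;> rw [hm] at this <;>
            exact ⟨this.2.1, this.2.2.2.1, this.2.2.2.2⟩
        simp only [h, drawMean_add, drawMean_const hqp]
        have hl : AffineOn X (T.left X j (X i j)).cases (nextResid θ pick X S.1 T r) z := by
          have hlt : ∀ k ∈ (T.left X j (X i j)).cases, X k j ≤ X i j :=
            fun k hk => (Finset.mem_filter.1 hk).2
          rcases hm with hm | hm
          · refine hr.sub_line (Finset.filter_subset _ _) j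
              (avg (T.left X j (X i j)).cases r) 0 fun k hk => ?_
            simp [nextResid, hm, Model.fit, hlt k hk]
          · refine hr.sub_lsLine (Finset.filter_subset _ _) j
              (T.left X j (X i j)).cases r fun k hk => ?_
            simp only [nextResid, hm, Model.fit, if_pos (hlt k hk)]
        have hr' : AffineOn X (T.right X j (X i j)).cases (nextResid θ pick X S.1 T r) z := by
          have hlt : ∀ k ∈ (T.right X j (X i j)).cases, ¬ X k j ≤ X i j :=
            fun k hk => not_le.2 (Finset.mem_filter.1 hk).2
          rcases hm with hm | hm
          · refine hr.sub_line (Finset.filter_subset _ _) j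
              (avg (T.right X j (X i j)).cases r) 0 fun k hk => ?_
            simp [nextResid, hm, Model.fit, hlt k hk]
          · refine hr.sub_lsLine (Finset.filter_subset _ _) j
              (T.right X j (X i j)).cases r fun k hk => ?_
            simp only [nextResid, hm, Model.fit, if_neg (hlt k hk)]
        have h1 := IH _ (.left hT j hall.1 hall.2.1) _ hl
        have h2 := IH _ (.right hT j hall.1 hall.2.2) _ hr'
        rw [← Node.sum_left_add_sum_right X T j (X i j)] at hle'
        rw [← Node.sum_left_add_sum_right X T j (X i j)
          (fun i => nextResid θ pick X S.1 T r i ^ 2), hZ,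
          ← Node.sum_left_add_sum_right X T j (X i j) (fun i => z i ^ 2)]
        linarith
    rw [drawMean_succ]
    have h1 := Finset.sum_le_sum fun S (_ : S ∈ Finset.univ) => hS S
    simp only [Finset.sum_add_distrib, ← Finset.mul_sum,
      Finset.sum_sub_distrib, Finset.sum_const, Finset.card_univ, nsmul_eq_mul] at h1
    rw [← hNdef] at h1
    set W := ∑ S : {S : Finset (Fin p) // S.card = q},
      (pick (Model.best θ X S.1 T r)).rss X T r with hW
    have h2 := div_le_div_of_nonneg_right h1 hN.le
    have h3 : ((1 - κ') ^ K * (W - N * Z) + e * s * (N * R) + N * Z) / N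
        = (1 - κ') ^ K * (W / N - Z) + e * s * R + Z := by
      field_simp
    rw [h3] at h2
    have h4 := mul_le_mul_of_nonneg_left hstep hpow
    have h5 : ∑ k ∈ Finset.range (K + 1), (1 - κ') ^ k = s + (1 - κ') ^ K :=
      Finset.sum_range_succ _ _
    rw [h5, pow_succ]
    linarith

end Contraction

/-! ### Hyperrectangles of nodes -/

section Boxes

variable {n p : ℕ}

/-- The side of a hyperrectangle in direction `j`: the part of the unit interval above the value in
case `a j` and up to the value in case `b j`. Where `a j` or `b j` is `none`, the side extends to
the boundary of the cube. -/
def side (x : Fin n → Fin p → ℝ) (a b : Fin p → Option (Fin n)) (j : Fin p) : Set ℝ :=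
  {y | (0 ≤ y ∧ y ≤ 1) ∧ (∀ i, a j = some i → x i j < y) ∧ ∀ i, b j = some i → y ≤ x i j}

/-- The hyperrectangle whose bounds are values of the predictors in the cases given by `a` and
`b`. -/
def box (x : Fin n → Fin p → ℝ) (a b : Fin p → Option (Fin n)) : Set (Fin p → ℝ) :=
  Set.univ.pi (side x a b)

theorem mem_box {x : Fin n → Fin p → ℝ} {a b : Fin p → Option (Fin n)} {y : Fin p → ℝ} :
    y ∈ box x a b ↔ ∀ j, (0 ≤ y j ∧ y j ≤ 1) ∧ (∀ i, a j = some i → x i j < y j) ∧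
      ∀ i, b j = some i → y j ≤ x i j := by
  simp [box, side]

theorem box_subset (x : Fin n → Fin p → ℝ) (a b : Fin p → Option (Fin n)) :
    box x a b ⊆ Set.Icc 0 1 :=
  fun _ hy => ⟨fun j => (mem_box.1 hy j).1.1, fun j => (mem_box.1 hy j).1.2⟩

theorem ordConnected_side (x : Fin n → Fin p → ℝ) (a b : Fin p → Option (Fin n)) (j : Fin p) :
    (side x a b j).OrdConnected := by
  constructor
  rintro u ⟨⟨hu0, hu1⟩, hua, hub⟩ v ⟨⟨hv0, hv1⟩, hva, hvb⟩ w ⟨hw1, hw2⟩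
  exact ⟨⟨hu0.trans hw1, hw2.trans hv1⟩, fun i hi => (hua i hi).trans_le hw1,
    fun i hi => hw2.trans (hvb i hi)⟩

theorem measurableSet_box (x : Fin n → Fin p → ℝ) (a b : Fin p → Option (Fin n)) :
    MeasurableSet (box x a b) :=
  MeasurableSet.univ_pi fun j => (ordConnected_side x a b j).measurableSet

/-- The node `T` consists of the cases in a box with bounds among the data. -/
def IsBox (X : Fin n → Fin p → ℝ) (T : Node n p) (a b : Fin p → Option (Fin n)) : Prop :=
  (∀ i, i ∈ T.cases ↔ X i ∈ box X a b) ∧ (∀ j, T.lo j = (a j).elim 0 fun i => X i j) ∧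
    ∀ j, T.hi j = (b j).elim 1 fun i => X i j

theorem isBox_root {X : Fin n → Fin p → ℝ} (hX : ∀ i, X i ∈ Set.Icc 0 1) :
    IsBox X (Node.root n p) (fun _ => none) (fun _ => none) := by
  refine ⟨fun i => ⟨fun _ => mem_box.2 fun j => ⟨⟨(hX i).1 j, (hX i).2 j⟩, by simp, by simp⟩,
    fun _ => Finset.mem_univ _⟩, fun _ => rfl, fun _ => rfl⟩

theorem IsBox.left {X : Fin n → Fin p → ℝ} {T : Node n p} {a b : Fin p → Option (Fin n)}
    (h : IsBox X T a b) (j : Fin p) {i : Fin n} (hi : i ∈ T.cases) :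
    IsBox X (T.left X j (X i j)) a (Function.update b j (some i)) := by
  refine ⟨fun k => ?_, h.2.1, fun l => ?_⟩
  · have hib := mem_box.1 ((h.1 i).1 hi)
    simp only [Node.left, Finset.mem_filter, h.1 k, mem_box]
    constructor
    · rintro ⟨hk, hkj⟩ l
      refine ⟨(hk l).1, (hk l).2.1, fun m hm => ?_⟩
      by_cases hl : l = j
      · subst hl
        simp only [Function.update_self, Option.some.injEq] at hm
        rwa [← hm]
      · rw [Function.update_of_ne hl] at hm
        exact (hk l).2.2 m hm
    · intro hk
      have hkj : X k j ≤ X i j := (hk j).2.2 i (Function.update_self _ _ _)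
      refine ⟨fun l => ⟨(hk l).1, (hk l).2.1, fun m hm => ?_⟩, hkj⟩
      by_cases hl : l = j
      · subst hl
        exact hkj.trans ((hib l).2.2 m hm)
      · exact (hk l).2.2 m (by rwa [Function.update_of_ne hl])
  · simp only [Node.left]
    by_cases hl : l = j
    · subst hl; simp
    · simp [Function.update_of_ne hl, h.2.2 l]

theorem IsBox.right {X : Fin n → Fin p → ℝ} {T : Node n p} {a b : Fin p → Option (Fin n)}
    (h : IsBox X T a b) (j : Fin p) {i : Fin n} (hi : i ∈ T.cases) :
    IsBox X (T.right X j (X i j)) (Function.update a j (some i)) b := by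
  refine ⟨fun k => ?_, fun l => ?_, h.2.2⟩
  · have hib := mem_box.1 ((h.1 i).1 hi)
    simp only [Node.right, Finset.mem_filter, h.1 k, mem_box]
    constructor
    · rintro ⟨hk, hkj⟩ l
      refine ⟨(hk l).1, fun m hm => ?_, (hk l).2.2⟩
      by_cases hl : l = j
      · subst hl
        simp only [Function.update_self, Option.some.injEq] at hm
        rwa [← hm]
      · rw [Function.update_of_ne hl] at hm
        exact (hk l).2.1 m hm
    · intro hk
      have hkj : X i j < X k j := (hk j).2.1 i (Function.update_self _ _ _)
      refine ⟨fun l => ⟨(hk l).1, fun m hm => ?_, (hk l).2.2⟩, hkj⟩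
      by_cases hl : l = j
      · subst hl
        exact ((hib l).2.1 m hm).trans hkj
      · exact (hk l).2.1 m (by rwa [Function.update_of_ne hl])
  · simp only [Node.right]
    by_cases hl : l = j
    · subst hl; simp
    · simp [Function.update_of_ne hl, h.2.1 l]

theorem Reached.exists_isBox {θ : Tuning} {X : Fin n → Fin p → ℝ}
    (hX : ∀ i, X i ∈ Set.Icc 0 1) {T : Node n p} (h : Reached θ X T) :
    ∃ a b, IsBox X T a b := by
  induction h with
  | root => exact ⟨_, _, isBox_root hX⟩
  | left hT j hi hL IH =>
    obtain ⟨a, b, h⟩ := IH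
    exact ⟨_, _, h.left j hi⟩
  | right hT j hi hL IH =>
    obtain ⟨a, b, h⟩ := IH
    exact ⟨_, _, h.right j hi⟩

/-- The volume of a node with at least one case is that of its box. For an empty node the formula
could multiply negative lengths. -/
theorem IsBox.volume_real {X : Fin n → Fin p → ℝ} (hX : ∀ i, X i ∈ Set.Icc 0 1) {T : Node n p}
    {a b : Fin p → Option (Fin n)} (h : IsBox X T a b) (hne : T.cases.Nonempty) :
    (volume : Measure (Fin p → ℝ)).real (box X a b) = T.vol := by
  obtain ⟨i, hi⟩ := hne
  have hib := mem_box.1 ((h.1 i).1 hi)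
  have hlo : ∀ j, 0 ≤ T.lo j ∧ T.lo j ≤ X i j := by
    intro j
    rw [h.2.1 j]
    rcases ha : a j with _ | k
    · exact ⟨le_rfl, (hX i).1 j⟩
    · exact ⟨(hX k).1 j, ((hib j).2.1 k ha).le⟩
  have hhi : ∀ j, T.hi j ≤ 1 ∧ X i j ≤ T.hi j := by
    intro j
    rw [h.2.2 j]
    rcases hb : b j with _ | k
    · exact ⟨le_rfl, (hX i).2 j⟩
    · exact ⟨(hX k).2 j, (hib j).2.2 k hb⟩
  have hside : ∀ j, volume (side X a b j) = ENNReal.ofReal (T.hi j - T.lo j) := by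
    intro j
    apply le_antisymm
    · rw [← Real.volume_Icc]
      refine measure_mono fun y hy => ⟨?_, ?_⟩
      · rw [h.2.1 j]
        rcases ha : a j with _ | k
        · exact hy.1.1
        · exact (hy.2.1 k ha).le
      · rw [h.2.2 j]
        rcases hb : b j with _ | k
        · exact hy.1.2
        · exact hy.2.2 k hb
    · rw [← Real.volume_Ioc]
      refine measure_mono fun y hy => ⟨⟨(hlo j).1.trans hy.1.le, hy.2.trans (hhi j).1⟩,
        fun k hk => ?_, fun k hk => ?_⟩
      · have := hy.1; rw [h.2.1 j, hk] at this; exact this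
      · have := hy.2; rw [h.2.2 j, hk] at this; exact this
  rw [Measure.real, box, volume_pi_pi, ENNReal.toReal_prod, Node.vol]
  refine Finset.prod_congr rfl fun j _ => ?_
  rw [hside, ENNReal.toReal_ofReal]
  linarith [(hlo j).2, (hhi j).2]

end Boxes

/-! ### Sample and population correlations in a box -/

section Correlations

variable {n p : ℕ}

/-- The monomials of degree at most two with degree at most one in each of two factors: `1`, the
coordinates, and the products of two coordinates. -/
def mon (u : Option (Fin p) × Option (Fin p)) (y : Fin p → ℝ) : ℝ :=
  u.1.elim 1 y * u.2.elim 1 y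

theorem mon_mem {u : Option (Fin p) × Option (Fin p)} {y : Fin p → ℝ} (hy : y ∈ Set.Icc 0 1) :
    0 ≤ mon u y ∧ mon u y ≤ 1 := by
  have h : ∀ v : Option (Fin p), 0 ≤ v.elim 1 y ∧ v.elim 1 y ≤ 1 := by
    rintro (_ | j)
    · simp
    · exact ⟨hy.1 j, hy.2 j⟩
  exact ⟨mul_nonneg (h _).1 (h _).1, mul_le_one₀ (h _).2 (h _).1 (h _).2⟩

theorem measurable_mon (u : Option (Fin p) × Option (Fin p)) : Measurable (mon u) := by
  have h : ∀ v : Option (Fin p), Measurable fun y : Fin p → ℝ => v.elim 1 y := by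
    rintro (_ | j)
    · exact measurable_const
    · exact measurable_pi_apply j
  exact (h _).mul (h _)

/-- Mean of a monomial given that the predictors are in `C`. It is `0` if `C` has probability
`0`. -/
noncomputable def cmean (P : Measure (Fin p → ℝ)) (C : Set (Fin p → ℝ))
    (u : Option (Fin p) × Option (Fin p)) : ℝ :=
  ∫ y, mon u y ∂P[|C]

variable {P : Measure (Fin p → ℝ)} {C : Set (Fin p → ℝ)}

theorem ae_cond_mem_cube (hCm : MeasurableSet C) (hC : C ⊆ Set.Icc 0 1) :
    ∀ᵐ y ∂P[|C], y ∈ Set.Icc (0 : Fin p → ℝ) 1 :=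
  (ae_cond_mem hCm).mono fun _ hy => hC hy

theorem integrable_mon [IsProbabilityMeasure P] (hCm : MeasurableSet C) (hC : C ⊆ Set.Icc 0 1)
    (u : Option (Fin p) × Option (Fin p)) : Integrable (mon u) P[|C] := by
  refine Integrable.of_bound (measurable_mon u).aestronglyMeasurable 1 ?_
  filter_upwards [ae_cond_mem_cube hCm hC] with y hy
  rw [Real.norm_eq_abs, abs_of_nonneg (mon_mem hy).1]
  exact (mon_mem hy).2

theorem cmean_mem [IsProbabilityMeasure P] (hCm : MeasurableSet C) (hC : C ⊆ Set.Icc 0 1)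
    (u : Option (Fin p) × Option (Fin p)) : 0 ≤ cmean P C u ∧ cmean P C u ≤ 1 := by
  constructor
  · refine integral_nonneg_of_ae ?_
    filter_upwards [ae_cond_mem_cube hCm hC] with y hy using (mon_mem hy).1
  · by_cases h0 : P C = 0
    · rw [cmean, cond_eq_zero_of_meas_eq_zero h0]; simp
    have := cond_isProbabilityMeasure h0
    calc cmean P C u ≤ ∫ _, (1 : ℝ) ∂P[|C] := by
          refine integral_mono_ae (integrable_mon hCm hC u) (integrable_const _) ?_
          filter_upwards [ae_cond_mem_cube hCm hC] with y hy using (mon_mem hy).2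
      _ = 1 := by simp

theorem memLp_coord [IsProbabilityMeasure P] (hCm : MeasurableSet C) (hC : C ⊆ Set.Icc 0 1) (j : Fin p) :
    MemLp (fun y : Fin p → ℝ => y j) 2 P[|C] := by
  refine MemLp.of_bound (measurable_pi_apply j).aestronglyMeasurable 1 ?_
  filter_upwards [ae_cond_mem_cube hCm hC] with y hy
  rw [Real.norm_eq_abs, abs_of_nonneg (hy.1 j)]
  exact hy.2 j

theorem cov_eq_cmean [IsProbabilityMeasure P] (hCm : MeasurableSet C) (hC : C ⊆ Set.Icc 0 1) (h0 : P C ≠ 0) (j k : Fin p) :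
    cov[fun y => y j, fun y => y k; P[|C]] = cmean P C (some j, some k)
      - cmean P C (some j, none) * cmean P C (some k, none) := by
  have := cond_isProbabilityMeasure h0
  rw [covariance_eq_sub (memLp_coord hCm hC j) (memLp_coord hCm hC k)]
  simp [cmean, mon]

/-- An eigenvalue bound for the correlation matrix bounds the covariance form from below. All
variances are positive since the diagonal of the correlation matrix is. -/
theorem cov_form_of_posSemidef (ν : Measure (Fin p → ℝ)) [IsProbabilityMeasure ν]
    (hν : ∀ j, MemLp (fun y : Fin p → ℝ => y j) 2 ν) {l : ℝ} (hl : 0 < l)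
    (h : (corMatrix ν - (2 * l) • (1 : Matrix (Fin p) (Fin p) ℝ)).PosSemidef) :
    (∀ j, 0 < cov[fun y => y j, fun y => y j; ν]) ∧ (∀ _ : Fin p, 2 * l ≤ 1) ∧
    ∀ b : Fin p → ℝ, 2 * l * ∑ j, b j ^ 2 * cov[fun y => y j, fun y => y j; ν]
      ≤ ∑ j, ∑ k, b j * b k * cov[fun y => y j, fun y => y k; ν] := by
  have hvar : ∀ j, cov[fun y : Fin p → ℝ => y j, fun y => y j; ν] = Var[fun y => y j; ν] :=
    fun j => covariance_self (hν j).aemeasurable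
  have hv0 : ∀ j, 0 ≤ Var[fun y : Fin p → ℝ => y j; ν] := fun j => variance_nonneg _ _
  have hdiag : ∀ j, 2 * l ≤ corMatrix ν j j := by
    intro j
    have := h.diag_nonneg (i := j)
    simpa using this
  have hpos : ∀ j, 0 < Var[fun y : Fin p → ℝ => y j; ν] := by
    intro j
    refine lt_of_le_of_ne (hv0 j) fun h0 => ?_
    have := hdiag j
    simp only [corMatrix, Matrix.of_apply, ← h0] at this
    simp at this
    linarith
  refine ⟨fun j => by rw [hvar]; exact hpos j, fun j => ?_, fun b => ?_⟩
  · have := hdiag j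
    simp only [corMatrix, Matrix.of_apply, hvar, Real.mul_self_sqrt (hv0 j)] at this
    rwa [div_self (hpos j).ne'] at this
  set s : Fin p → ℝ := fun j => √(Var[fun y : Fin p → ℝ => y j; ν]) with hs
  have hs0 : ∀ j, s j ≠ 0 := fun j => (Real.sqrt_pos.2 (hpos j)).ne'
  have hss : ∀ j, s j ^ 2 = cov[fun y => y j, fun y => y j; ν] := fun j => by
    rw [hvar]; exact Real.sq_sqrt (hv0 j)
  have hq := h.dotProduct_mulVec_nonneg fun j => b j * s j
  have h1 : star (fun j => b j * s j) ⬝ᵥ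
      ((corMatrix ν - (2 * l) • (1 : Matrix (Fin p) (Fin p) ℝ)).mulVec fun j => b j * s j)
      = ∑ j, ∑ k, b j * b k * cov[fun y => y j, fun y => y k; ν]
        - 2 * l * ∑ j, b j ^ 2 * cov[fun y => y j, fun y => y j; ν] := by
    rw [Matrix.sub_mulVec, dotProduct_sub]
    congr 1
    · simp only [dotProduct, Matrix.mulVec, Finset.mul_sum]
      refine Finset.sum_congr rfl fun j _ => Finset.sum_congr rfl fun k _ => ?_
      have e : corMatrix ν j k = cov[fun y => y j, fun y => y k; ν] / (s j * s k) := rfl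
      rw [e]
      have := hs0 j
      have := hs0 k
      simp only [Pi.star_apply, star_trivial]
      field_simp
    · rw [Matrix.smul_mulVec, Matrix.one_mulVec, dotProduct_smul, smul_eq_mul]
      congr 1
      refine Finset.sum_congr rfl fun j _ => ?_
      rw [← hss]
      simp only [Pi.star_apply, star_trivial]
      ring
  rw [h1] at hq
  linarith

/-- Sample covariances close to the population covariances inherit the conditioning: at most half
of the eigenvalue bound is lost. -/
theorem wellConditioned_of_close [IsProbabilityMeasure P] (hCm : MeasurableSet C) (hC : C ⊆ Set.Icc 0 1) (h0 : P C ≠ 0)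
    {l : ℝ} (hl : 0 < l)
    (hcor : (corMatrix P[|C] - (2 * l) • (1 : Matrix (Fin p) (Fin p) ℝ)).PosSemidef)
    {x : Fin n → Fin p → ℝ} {A : Finset (Fin n)} (hA : A.Nonempty)
    (hx : ∀ i ∈ A, x i ∈ Set.Icc (0 : Fin p → ℝ) 1) {τ v : ℝ} (hv : 0 < v)
    (hτ : (2 * l + p) * (3 * τ) ≤ l * v)
    (hclose : ∀ u, |avg A (fun i => mon u (x i)) - cmean P C u| ≤ τ)
    (hvar : (∀ j, v ≤ scov A (fun i => x i j) (fun i => x i j)) ∨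
      ∀ j, 2 * v ≤ cov[fun y => y j, fun y => y j; P[|C]] ∧ 3 * τ ≤ v) :
    WellConditioned A (fun j i => x i j) l := by
  have := cond_isProbabilityMeasure h0
  obtain ⟨-, -, hform⟩ := cov_form_of_posSemidef P[|C] (memLp_coord hCm hC) hl hcor
  have hτ0 : 0 ≤ τ := (abs_nonneg _).trans (hclose (none, none))
  have hcov : ∀ j k, |scov A (fun i => x i j) (fun i => x i k)
      - cov[fun y => y j, fun y => y k; P[|C]]| ≤ 3 * τ := by
    intro j k
    rw [cov_eq_cmean hCm hC h0, scov_eq hA]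
    have h1 := hclose (some j, some k)
    have h2 := hclose (some j, none)
    have h3 := hclose (some k, none)
    simp only [mon, Option.elim_some, Option.elim_none, mul_one] at h1 h2 h3
    have m2 := cmean_mem (P := P) hCm hC (some j, none)
    have m3 : 0 ≤ avg A (fun i => x i k) ∧ avg A (fun i => x i k) ≤ 1 :=
      ⟨avg_nonneg fun i hi => (hx i hi).1 k,
        (avg_le_avg fun i hi => (hx i hi).2 k).trans_eq (avg_const hA 1)⟩
    have h4 : |avg A (fun i => x i j) * avg A (fun i => x i k)
        - cmean P C (some j, none) * cmean P C (some k, none)| ≤ 2 * τ := by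
      have : avg A (fun i => x i j) * avg A (fun i => x i k)
          - cmean P C (some j, none) * cmean P C (some k, none)
          = (avg A (fun i => x i j) - cmean P C (some j, none)) * avg A (fun i => x i k)
            + cmean P C (some j, none) * (avg A (fun i => x i k) - cmean P C (some k, none)) := by
        ring
      rw [this]
      refine (abs_add_le _ _).trans ?_
      rw [abs_mul, abs_mul, abs_of_nonneg m3.1, abs_of_nonneg m2.1]
      have e1 := mul_le_mul h2 m3.2 m3.1 hτ0
      have e2 := mul_le_mul m2.2 h3 (abs_nonneg _) zero_le_one
      linarith
    rw [abs_le] at h1 h4 ⊢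
    constructor <;> linarith [h1.1, h1.2, h4.1, h4.2]
  have hvar' : ∀ j, v ≤ scov A (fun i => x i j) (fun i => x i j) := by
    rcases hvar with h | h
    · exact h
    · intro j
      have := (abs_le.1 (hcov j j)).1
      linarith [h j]
  refine ⟨fun j => hv.trans_le (hvar' j), fun b => ?_⟩
  have e1 : 2 * l * ∑ j, b j ^ 2 * scov A (fun i => x i j) (fun i => x i j)
      ≤ 2 * l * ∑ j, b j ^ 2 * cov[fun y => y j, fun y => y j; P[|C]]
        + 2 * l * (3 * τ) * ∑ j, b j ^ 2 := by
    have hsum : 3 * τ * ∑ j, b j ^ 2 = ∑ j, 3 * τ * b j ^ 2 := Finset.mul_sum _ _ _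
    rw [mul_assoc (2 * l) (3 * τ), hsum, ← mul_add, ← Finset.sum_add_distrib]
    refine mul_le_mul_of_nonneg_left (Finset.sum_le_sum fun j _ => ?_) (by positivity)
    nlinarith [(abs_le.1 (hcov j j)).2, sq_nonneg (b j)]
  have e2 : ∑ j, ∑ k, b j * b k * cov[fun y => y j, fun y => y k; P[|C]]
      ≤ ∑ j, ∑ k, b j * b k * scov A (fun i => x i j) (fun i => x i k)
        + p * (3 * τ) * ∑ j, b j ^ 2 := by
    have h1 : ∑ j, ∑ k, |b j| * |b k| * (3 * τ) ≤ p * (3 * τ) * ∑ j, b j ^ 2 := by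
      have h2 := sq_sum_le_card_mul_sum_sq (s := Finset.univ) (f := fun j => |b j|)
      simp only [sq_abs, Finset.card_univ, Fintype.card_fin] at h2
      have h3 : ∑ j, ∑ k, |b j| * |b k| * (3 * τ) = (∑ j, |b j|) ^ 2 * (3 * τ) := by
        rw [sq, Finset.sum_mul_sum]
        simp only [Finset.sum_mul]
      rw [h3]
      calc (∑ j, |b j|) ^ 2 * (3 * τ) ≤ (p * ∑ j, b j ^ 2) * (3 * τ) :=
            mul_le_mul_of_nonneg_right h2 (by positivity)
        _ = _ := by ring
    refine le_trans ?_ (add_le_add le_rfl h1)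
    rw [← Finset.sum_add_distrib]
    refine Finset.sum_le_sum fun j _ => ?_
    rw [← Finset.sum_add_distrib]
    refine Finset.sum_le_sum fun k _ => ?_
    have h4 : b j * b k * (cov[fun y => y j, fun y => y k; P[|C]]
        - scov A (fun i => x i j) (fun i => x i k)) ≤ |b j| * |b k| * (3 * τ) := by
      refine (le_abs_self _).trans ?_
      rw [abs_mul, abs_mul, abs_sub_comm]
      exact mul_le_mul_of_nonneg_left (hcov j k) (by positivity)
    linarith
  have e3 : (2 * l + p) * (3 * τ) * ∑ j, b j ^ 2
      ≤ l * ∑ j, b j ^ 2 * scov A (fun i => x i j) (fun i => x i j) := by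
    calc (2 * l + p) * (3 * τ) * ∑ j, b j ^ 2 ≤ l * v * ∑ j, b j ^ 2 :=
          mul_le_mul_of_nonneg_right hτ (Finset.sum_nonneg fun _ _ => sq_nonneg _)
      _ = l * ∑ j, b j ^ 2 * v := by rw [← Finset.sum_mul]; ring
      _ ≤ _ := by
          refine mul_le_mul_of_nonneg_left (Finset.sum_le_sum fun j _ => ?_) hl.le
          exact mul_le_mul_of_nonneg_left (hvar' j) (sq_nonneg _)
  have := hform b
  linarith

end Correlations

/-! ### Uniform concentration over boxes spanned by data -/

section Concentration

/-- Integrating out independent coordinates one by one. The factors may depend on the coordinates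
outside `s`, but not on those inside `s` other than through the second argument. -/
theorem lintegral_prod_le_one {ι E : Type*} [Fintype ι] [MeasurableSpace E] (P : Measure E)
    [IsProbabilityMeasure P] (g : (ι → E) → E → ENNReal) (hg : Measurable (Function.uncurry g))
    (hint : ∀ x, ∫⁻ y, g x y ∂P ≤ 1) (s : Finset ι)
    (hdep : ∀ x x' : ι → E, (∀ i ∉ s, x i = x' i) → g x = g x') :
    ∫⁻ x, ∏ i ∈ s, g x (x i) ∂(Measure.pi fun _ : ι => P) ≤ 1 := by
  have hmeas : ∀ t : Finset ι, Measurable fun x : ι → E => ∏ i ∈ t, g x (x i) := fun t =>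
    Finset.measurable_prod _ fun i _ =>
      hg.comp (measurable_id.prodMk (measurable_pi_apply i))
  have key : ∀ t : Finset ι, t ⊆ s → ∀ x,
      (∫⋯∫⁻_t, (fun x => ∏ i ∈ t, g x (x i)) ∂fun _ : ι => P) x ≤ 1 := by
    intro t
    induction t using Finset.induction_on with
    | empty => intro _ x; simp
    | insert i t hi IH =>
      intro hts x
      have his : i ∈ s := hts (Finset.mem_insert_self i t)
      rw [lmarginal_insert' _ (hmeas _) hi]
      refine le_trans (lmarginal_mono (fun x => ?_) x)
        (IH ((Finset.subset_insert i t).trans hts) x)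
      have hupd : ∀ y, ∏ k ∈ insert i t, g (Function.update x i y) (Function.update x i y k)
          = g x y * ∏ k ∈ t, g x (x k) := by
        intro y
        have hgx : g (Function.update x i y) = g x := by
          refine hdep _ _ fun k hk => Function.update_of_ne ?_ _ _
          rintro rfl; exact hk his
        rw [Finset.prod_insert hi, hgx, Function.update_self]
        congr 1
        refine Finset.prod_congr rfl fun k hk => ?_
        rw [Function.update_of_ne]
        rintro rfl; exact hi hk
      simp only [hupd]
      have hgx : Measurable (g x) := hg.comp (measurable_const.prodMk measurable_id)
      rw [lintegral_mul_const _ hgx]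
      exact mul_le_of_le_one_left zero_le (hint x)
  obtain ⟨x₀⟩ : Nonempty (ι → E) := by
    have : Nonempty E := nonempty_of_isProbabilityMeasure P
    infer_instance
  rw [lintegral_eq_lmarginal_univ x₀, ← Finset.union_compl s,
    lmarginal_union' _ _ (hmeas s) disjoint_compl_right]
  refine le_trans (lmarginal_mono (g := fun _ => 1) (fun x => key s subset_rfl x) x₀) ?_
  simp [lmarginal]

variable {n p : ℕ} {P : Measure (Fin p → ℝ)} [IsProbabilityMeasure P]

/-- Exponential moment of a centred bounded variable on a set `C`, normalized by the number of
visits to `C`. Points outside `C` contribute the factor `1`, so that no conditioning on that number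
is needed. -/
theorem lintegral_exp_le_one {C : Set (Fin p → ℝ)} (hCm : MeasurableSet C)
    (hC : C ⊆ Set.Icc 0 1) (u : Option (Fin p) × Option (Fin p)) {s t : ℝ} (hs : |s| ≤ t)
    (ht : t ≤ 1) :
    ∫⁻ y, ENNReal.ofReal (Real.exp (if y ∈ C then s * (mon u y - cmean P C u) - t ^ 2 else 0)) ∂P
      ≤ 1 := by
  have ht0 : 0 ≤ t := (abs_nonneg s).trans hs
  set m := cmean P C u with hm
  have hm01 := cmean_mem (P := P) hCm hC u
  rw [← hm] at hm01
  set w : (Fin p → ℝ) → ℝ := C.indicator fun y => s * (mon u y - m) with hw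
  have hz : ∀ y ∈ C, |s * (mon u y - m)| ≤ t := by
    intro y hy
    have h1 := mon_mem (u := u) (hC hy)
    rw [abs_mul]
    have : |mon u y - m| ≤ 1 := abs_le.2 ⟨by linarith [h1.1, h1.2], by linarith [h1.1, h1.2]⟩
    calc |s| * |mon u y - m| ≤ t * 1 := mul_le_mul hs this (abs_nonneg _) ht0
      _ = t := mul_one t
  have hwb : ∀ y, |w y| ≤ t := by
    intro y
    by_cases hy : y ∈ C
    · rw [hw, Set.indicator_of_mem hy]; exact hz y hy
    · rw [hw, Set.indicator_of_notMem hy]; simpa using ht0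
  have hwm : Measurable w :=
    (measurable_const.mul ((measurable_mon u).sub measurable_const)).indicator hCm
  have hwi : Integrable w P := Integrable.of_bound hwm.aestronglyMeasurable t
    (Filter.Eventually.of_forall hwb)
  have he0 := Real.exp_pos (-t ^ 2)
  have hpt : ∀ y, Real.exp (if y ∈ C then s * (mon u y - m) - t ^ 2 else 0)
      ≤ 1 + Real.exp (-t ^ 2) * w y := by
    intro y
    by_cases hy : y ∈ C
    · rw [if_pos hy, hw, Set.indicator_of_mem hy]
      set z := s * (mon u y - m)
      have hzt := hz y hy
      have h2 := (abs_le.1 (Real.abs_exp_sub_one_sub_id_le (hzt.trans ht))).2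
      have h3 : z ^ 2 ≤ t ^ 2 := sq_le_sq.2 (by rwa [abs_of_nonneg ht0])
      have h4 : t ^ 2 + 1 ≤ Real.exp (t ^ 2) := Real.add_one_le_exp _
      have h5 : Real.exp (-t ^ 2) * Real.exp (t ^ 2) = 1 := by
        rw [← Real.exp_add]; simp
      rw [sub_eq_add_neg, Real.exp_add, mul_comm]
      nlinarith
    · rw [if_neg hy, hw, Set.indicator_of_notMem hy]; simp
  have hint : ∫ y, w y ∂P = 0 := by
    rw [hw, integral_indicator hCm, integral_const_mul]
    have hf : IntegrableOn (mon u) C P := by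
      refine Integrable.of_bound (measurable_mon u).aestronglyMeasurable 1 ?_
      filter_upwards [ae_restrict_mem hCm] with y hy
      have h1 := mon_mem (u := u) (hC hy)
      rw [Real.norm_eq_abs, abs_of_nonneg h1.1]; exact h1.2
    rw [integral_sub hf (integrable_const _), setIntegral_const, smul_eq_mul, hm, cmean,
      ProbabilityTheory.cond, integral_smul_measure, ENNReal.toReal_inv, smul_eq_mul]
    by_cases h0 : P C = 0
    · simp [Measure.restrict_eq_zero.2 h0]
    · have : P.real C ≠ 0 := (ENNReal.toReal_pos h0 (measure_ne_top _ _)).ne'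
      rw [Measure.real] at this ⊢
      field_simp
      simp
  calc _ ≤ ∫⁻ y, ENNReal.ofReal (1 + Real.exp (-t ^ 2) * w y) ∂P :=
        lintegral_mono fun y => ENNReal.ofReal_le_ofReal (hpt y)
    _ = ENNReal.ofReal (∫ y, (1 + Real.exp (-t ^ 2) * w y) ∂P) := by
        rw [ofReal_integral_eq_lintegral_ofReal]
        · exact (integrable_const _).add (hwi.const_mul _)
        · refine Filter.Eventually.of_forall fun y => (Real.exp_pos _).le.trans (hpt y)
    _ = 1 := by
        rw [integral_add (integrable_const _) (hwi.const_mul _), integral_const_mul, hint]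
        simp

theorem measurableSet_mem_box (a b : Fin p → Option (Fin n)) :
    MeasurableSet {z : (Fin n → Fin p → ℝ) × (Fin p → ℝ) | z.2 ∈ box z.1 a b} := by
  have hy : ∀ j, Measurable fun z : (Fin n → Fin p → ℝ) × (Fin p → ℝ) => z.2 j := fun j =>
    (measurable_pi_apply j).comp measurable_snd
  have hx : ∀ i j, Measurable fun z : (Fin n → Fin p → ℝ) × (Fin p → ℝ) => z.1 i j := fun i j =>
    (measurable_pi_apply j).comp ((measurable_pi_apply i).comp measurable_fst)
  simp only [mem_box]
  refine measurableSet_setOfPred.2 (Measurable.forall fun j => ?_)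
  refine Measurable.and (Measurable.and ?_ ?_) (Measurable.and ?_ ?_)
  · exact measurableSet_setOfPred.1 (measurableSet_le measurable_const (hy j))
  · exact measurableSet_setOfPred.1 (measurableSet_le (hy j) measurable_const)
  · refine Measurable.forall fun i => Measurable.imp measurable_const ?_
    exact measurableSet_setOfPred.1 (measurableSet_lt (hx i j) (hy j))
  · refine Measurable.forall fun i => Measurable.imp measurable_const ?_
    exact measurableSet_setOfPred.1 (measurableSet_le (hy j) (hx i j))

theorem measurable_cmean_box (a b : Fin p → Option (Fin n))
    (u : Option (Fin p) × Option (Fin p)) :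
    Measurable fun x : Fin n → Fin p → ℝ => cmean P (box x a b) u := by
  have hB := measurableSet_mem_box a b
  have h1 : Measurable fun x : Fin n → Fin p → ℝ => P (box x a b) :=
    measurable_measure_prodMk_left hB
  have h2 : Measurable fun x : Fin n → Fin p → ℝ => ∫ y in box x a b, mon u y ∂P := by
    have h3 : StronglyMeasurable fun z : (Fin n → Fin p → ℝ) × (Fin p → ℝ) =>
        {z : (Fin n → Fin p → ℝ) × (Fin p → ℝ) | z.2 ∈ box z.1 a b}.indicator
          (fun z => mon u z.2) z :=
      (((measurable_mon u).comp measurable_snd).indicator hB).stronglyMeasurable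
    have h4 := (h3.integral_prod_right' (ν := P)).measurable
    convert h4 using 2 with x
    rw [← integral_indicator (measurableSet_box x a b)]
    rfl
  have h5 : (fun x : Fin n → Fin p → ℝ => cmean P (box x a b) u)
      = fun x => ((P (box x a b))⁻¹).toReal * ∫ y in box x a b, mon u y ∂P := by
    funext x
    rw [cmean, ProbabilityTheory.cond, integral_smul_measure, smul_eq_mul]
  rw [h5]
  exact h1.inv.ennreal_toReal.mul h2

/-- The sampled points in a box. -/
noncomputable def boxCases (x : Fin n → Fin p → ℝ) (a b : Fin p → Option (Fin n)) :
    Finset (Fin n) :=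
  Finset.univ.filter fun i => x i ∈ box x a b

/-- Deviations of the sample mean over a box with at least `m` points, for fixed indices `a`, `b`
of the points that span it. The at most `2 * p` spanning points are set aside, which costs a
constant factor; given them the box is fixed and the other points are still independent. -/
theorem measure_deviation_le (a b : Fin p → Option (Fin n)) (u : Option (Fin p) × Option (Fin p))
    {τ σ : ℝ} (hτ : 0 ≤ τ) (hτ1 : τ ≤ 1) (hσ : |σ| = 1) (m : ℝ) :
    (Measure.pi fun _ : Fin n => P) {x | m ≤ (boxCases x a b).card ∧
      τ * (boxCases x a b).card
        < σ * ∑ i ∈ boxCases x a b, (mon u (x i) - cmean P (box x a b) u)}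
      ≤ ENNReal.ofReal (Real.exp (p * τ) * Real.exp (-(τ ^ 2 / 4 * m))) := by
  set t : ℝ := τ / 2 with ht
  have ht0 : 0 ≤ t := by positivity
  set h : (Fin n → Fin p → ℝ) → (Fin p → ℝ) → ℝ := fun x y =>
    if y ∈ box x a b then (t * σ) * (mon u y - cmean P (box x a b) u) - t ^ 2 else 0 with hh
  set I : Finset (Fin n) := Finset.univ.biUnion fun j => (a j).toFinset ∪ (b j).toFinset with hI
  have hIcard : (I.card : ℝ) ≤ 2 * p := by
    have : I.card ≤ ∑ _j : Fin p, 2 := by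
      refine Finset.card_biUnion_le.trans (Finset.sum_le_sum fun j _ => ?_)
      refine (Finset.card_union_le _ _).trans ?_
      have : ∀ o : Option (Fin n), o.toFinset.card ≤ 1 := by
        rintro (_ | i) <;> simp
      exact add_le_add (this _) (this _)
    simp at this
    have : (I.card : ℝ) ≤ ((p * 2 : ℕ) : ℝ) := by exact_mod_cast this
    push_cast at this; linarith
  have hIa : ∀ j i, a j = some i → i ∈ I := fun j i hi =>
    Finset.mem_biUnion.2 ⟨j, Finset.mem_univ _, Finset.mem_union_left _ (by simp [hi])⟩
  have hIb : ∀ j i, b j = some i → i ∈ I := fun j i hi =>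
    Finset.mem_biUnion.2 ⟨j, Finset.mem_univ _, Finset.mem_union_right _ (by simp [hi])⟩
  have hbox : ∀ x x' : Fin n → Fin p → ℝ, (∀ i ∉ Iᶜ, x i = x' i) →
      box x a b = box x' a b := by
    intro x x' hxx
    have hxx' : ∀ i ∈ I, x i = x' i := fun i hi => hxx i (by simpa using hi)
    ext y
    simp only [mem_box]
    refine forall_congr' fun j => and_congr_right fun _ => and_congr ?_ ?_
    · exact forall_congr' fun i => imp_congr_right fun hi => by rw [hxx' i (hIa j i hi)]
    · exact forall_congr' fun i => imp_congr_right fun hi => by rw [hxx' i (hIb j i hi)]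
  have hmeas : Measurable (Function.uncurry fun x y => ENNReal.ofReal (Real.exp (h x y))) := by
    refine (Real.measurable_exp.comp ?_).ennreal_ofReal
    refine Measurable.ite (measurableSet_mem_box a b) ?_ measurable_const
    exact (measurable_const.mul (((measurable_mon u).comp measurable_snd).sub
      ((measurable_cmean_box a b u).comp measurable_fst))).sub measurable_const
  have hle := lintegral_prod_le_one P (fun x y => ENNReal.ofReal (Real.exp (h x y))) hmeas
    (fun x => lintegral_exp_le_one (measurableSet_box x a b) (box_subset x a b) u
      (by rw [abs_mul, hσ, mul_one, abs_of_nonneg ht0]) (by linarith))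
    Iᶜ (fun x x' hxx => by simp only [hh, hbox x x' hxx])
  have hlow : ∀ x : Fin n → Fin p → ℝ, (m ≤ (boxCases x a b).card ∧
      τ * (boxCases x a b).card
        < σ * ∑ i ∈ boxCases x a b, (mon u (x i) - cmean P (box x a b) u)) →
      ENNReal.ofReal (Real.exp (τ ^ 2 / 4 * m - p * τ))
        ≤ ∏ i ∈ Iᶜ, ENNReal.ofReal (Real.exp (h x (x i))) := by
    rintro x ⟨hm, hdev⟩
    rw [← ENNReal.ofReal_prod_of_nonneg fun _ _ => (Real.exp_pos _).le, ← Real.exp_sum]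
    refine ENNReal.ofReal_le_ofReal (Real.exp_le_exp.2 ?_)
    have h1 : ∑ i ∈ Iᶜ, h x (x i) = ∑ i, h x (x i) - ∑ i ∈ I, h x (x i) := by
      rw [← Finset.sum_compl_add_sum I]; ring
    have h2 : ∑ i, h x (x i) = t * (σ * ∑ i ∈ boxCases x a b,
        (mon u (x i) - cmean P (box x a b) u)) - t ^ 2 * (boxCases x a b).card := by
      simp only [hh]
      rw [← Finset.sum_filter]
      simp only [Finset.sum_sub_distrib, ← Finset.mul_sum, Finset.sum_const, nsmul_eq_mul,
        boxCases]
      ring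
    have h3 : ∑ i ∈ I, h x (x i) ≤ 2 * p * t := by
      calc ∑ i ∈ I, h x (x i) ≤ ∑ _i ∈ I, t := by
            refine Finset.sum_le_sum fun i _ => ?_
            simp only [hh]
            split_ifs with hi
            · have e1 := mon_mem (u := u) (box_subset x a b hi)
              have e2 := cmean_mem (P := P) (measurableSet_box x a b) (box_subset x a b) u
              have e3 : |t * σ * (mon u (x i) - cmean P (box x a b) u)| ≤ t := by
                rw [abs_mul, abs_mul, hσ, mul_one, abs_of_nonneg ht0]
                refine mul_le_of_le_one_right ht0 (abs_le.2 ⟨?_, ?_⟩) <;>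
                  linarith [e1.1, e1.2, e2.1, e2.2]
              linarith [(abs_le.1 e3).2, sq_nonneg t]
            · exact ht0
        _ = I.card * t := by simp
        _ ≤ 2 * p * t := mul_le_mul_of_nonneg_right hIcard ht0
    have h4 := mul_le_mul_of_nonneg_left hdev.le ht0
    have h5 := mul_le_mul_of_nonneg_left hm (by positivity : 0 ≤ τ ^ 2 / 4)
    rw [h1, h2]
    have h6 : t * (τ * (boxCases x a b).card) - t ^ 2 * (boxCases x a b).card
        = τ ^ 2 / 4 * (boxCases x a b).card := by rw [ht]; ring
    have h7 : 2 * p * t = p * τ := by rw [ht]; ring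
    linarith
  refine (measure_mono fun x hx => hlow x hx).trans ?_
  have hmarkov := meas_ge_le_lintegral_div (μ := Measure.pi fun _ : Fin n => P)
    (f := fun x => ∏ i ∈ Iᶜ, ENNReal.ofReal (Real.exp (h x (x i))))
    (Finset.measurable_prod _ fun i _ =>
      hmeas.comp (measurable_id.prodMk (measurable_pi_apply i))).aemeasurable
    (ε := ENNReal.ofReal (Real.exp (τ ^ 2 / 4 * m - p * τ)))
    (by simpa using Real.exp_pos _) ENNReal.ofReal_ne_top
  refine hmarkov.trans ((ENNReal.div_le_div_right hle _).trans_eq ?_)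
  rw [one_div, ← ENNReal.ofReal_inv_of_pos (Real.exp_pos _), ← Real.exp_neg, ← Real.exp_add]
  congr 2
  ring

/-- In every box spanned by data that contains at least `m` of the points, the sample means of all
monomials differ by at most `τ` from the conditional means. -/
def UniformlyClose (P : Measure (Fin p → ℝ)) (m τ : ℝ) (x : Fin n → Fin p → ℝ) : Prop :=
  ∀ a b u, m ≤ (boxCases x a b).card →
    |∑ i ∈ boxCases x a b, (mon u (x i) - cmean P (box x a b) u)| ≤ τ * (boxCases x a b).card

theorem measure_not_uniformlyClose_le {τ : ℝ} (hτ : 0 ≤ τ) (hτ1 : τ ≤ 1) (m : ℝ) :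
    (Measure.pi fun _ : Fin n => P) {x | ¬ UniformlyClose P m τ x}
      ≤ ENNReal.ofReal (2 * (p + 1) ^ 2 * ((n + 1) ^ p) ^ 2
          * (Real.exp (p * τ) * Real.exp (-(τ ^ 2 / 4 * m)))) := by
  let J := (Fin p → Option (Fin n)) × (Fin p → Option (Fin n)) ×
    (Option (Fin p) × Option (Fin p)) × Bool
  have hsub : {x : Fin n → Fin p → ℝ | ¬ UniformlyClose P m τ x} ⊆ ⋃ k : J,
      {x | m ≤ (boxCases x k.1 k.2.1).card ∧ τ * (boxCases x k.1 k.2.1).card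
        < (if k.2.2.2 then 1 else -1) * ∑ i ∈ boxCases x k.1 k.2.1,
          (mon k.2.2.1 (x i) - cmean P (box x k.1 k.2.1) k.2.2.1)} := by
    intro x hx
    simp only [UniformlyClose, Set.mem_ofPred_eq, not_forall, not_le] at hx
    obtain ⟨a, b, u, hm, hdev⟩ := hx
    rcases lt_abs.1 hdev with h | h
    · exact Set.mem_iUnion.2 ⟨(a, b, u, true), hm, by simpa using h⟩
    · exact Set.mem_iUnion.2 ⟨(a, b, u, false), hm, by simpa using h⟩
  refine (measure_mono hsub).trans ((measure_iUnion_fintype_le _ _).trans ?_)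
  refine (Finset.sum_le_sum fun k _ => measure_deviation_le k.1 k.2.1 k.2.2.1 hτ hτ1
    (by split_ifs <;> simp) m).trans_eq ?_
  rw [Finset.sum_const, Finset.card_univ, ← ENNReal.ofReal_nsmul, nsmul_eq_mul]
  congr 2
  simp [J]
  ring

/-- A stretched exponential beats every power. -/
theorem exists_pow_mul_exp_neg_le {δ c : ℝ} (hδ : 0 < δ) (hc : 0 < c) (k : ℕ) :
    ∃ D : ℝ, 0 ≤ D ∧ ∀ n : ℕ, 1 ≤ n → (n : ℝ) ^ k * Real.exp (-(c * (n : ℝ) ^ δ)) ≤ D := by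
  obtain ⟨r, hr⟩ := exists_nat_ge (k / δ)
  refine ⟨r.factorial / c ^ r, by positivity, fun n hn => ?_⟩
  have hn1 : (1 : ℝ) ≤ n := by exact_mod_cast hn
  have hn0 : (0 : ℝ) ≤ n := by linarith
  have h1 : (n : ℝ) ^ k ≤ ((n : ℝ) ^ δ) ^ r := by
    rw [← Real.rpow_natCast, ← Real.rpow_natCast, ← Real.rpow_mul hn0]
    refine Real.rpow_le_rpow_of_exponent_le hn1 ?_
    rw [div_le_iff₀ hδ] at hr; linarith
  have h2 : (c * (n : ℝ) ^ δ) ^ r / r.factorial ≤ Real.exp (c * (n : ℝ) ^ δ) :=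
    Real.pow_div_factorial_le_exp _ (by positivity) r
  have h3 : ((n : ℝ) ^ δ) ^ r ≤ r.factorial / c ^ r * Real.exp (c * (n : ℝ) ^ δ) := by
    rw [div_le_iff₀ (by positivity), mul_pow] at h2
    rw [div_mul_eq_mul_div, le_div_iff₀ (by positivity)]
    linarith
  rw [Real.exp_neg, ← div_eq_mul_inv, div_le_iff₀ (Real.exp_pos _)]
  exact h1.trans h3

end Concentration

/-! ### Measurability of the tree -/

section Measurability

variable {Ω : Type*} [MeasurableSpace Ω] {n p q : ℕ}

theorem measurable_avg {A : Ω → Finset (Fin n)} {f : Ω → Fin n → ℝ}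
    (hA : ∀ i, MeasurableSet {ω | i ∈ A ω}) (hf : ∀ i, Measurable fun ω => f ω i) :
    Measurable fun ω => avg (A ω) (f ω) := by
  have h1 : ∀ g : Ω → Fin n → ℝ, (∀ i, Measurable fun ω => g ω i) →
      Measurable fun ω => ∑ i ∈ A ω, g ω i := by
    intro g hg
    have : (fun ω => ∑ i ∈ A ω, g ω i) = fun ω => ∑ i, if i ∈ A ω then g ω i else 0 := by
      funext ω; simp
    rw [this]
    exact Finset.measurable_sum _ fun i _ => Measurable.ite (hA i) (hg i) measurable_const
  have h2 : Measurable fun ω => ((A ω).card : ℝ) := by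
    simpa using h1 (fun _ _ => 1) fun _ => measurable_const
  exact (h1 f hf).div h2

theorem measurable_scov {A : Ω → Finset (Fin n)} {f g : Ω → Fin n → ℝ}
    (hA : ∀ i, MeasurableSet {ω | i ∈ A ω}) (hf : ∀ i, Measurable fun ω => f ω i)
    (hg : ∀ i, Measurable fun ω => g ω i) :
    Measurable fun ω => scov (A ω) (f ω) (g ω) :=
  measurable_avg hA fun i =>
    ((hf i).sub (measurable_avg hA hf)).mul ((hg i).sub (measurable_avg hA hg))

theorem measurable_lsLine {A : Ω → Finset (Fin n)} {f r : Ω → Fin n → ℝ} {u : Ω → ℝ}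
    (hA : ∀ i, MeasurableSet {ω | i ∈ A ω}) (hf : ∀ i, Measurable fun ω => f ω i)
    (hr : ∀ i, Measurable fun ω => r ω i) (hu : Measurable u) :
    Measurable fun ω => lsLine (A ω) (f ω) (r ω) (u ω) :=
  (measurable_avg hA hr).add (((measurable_scov hA hf hr).div (measurable_scov hA hf hf)).mul
    (hu.sub (measurable_avg hA hf)))

/-- A random node that depends measurably on the data. -/
structure MeasurableNode (T : Ω → Node n p) : Prop where
  cases : ∀ i, MeasurableSet {ω | i ∈ (T ω).cases}
  lo : ∀ j, Measurable fun ω => (T ω).lo j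
  hi : ∀ j, Measurable fun ω => (T ω).hi j

variable {X : Ω → Fin n → Fin p → ℝ} {T : Ω → Node n p} {r : Ω → Fin n → ℝ}

theorem measurable_update_apply {f : Ω → Fin p → ℝ} (hf : ∀ j, Measurable fun ω => f ω j)
    {g : Ω → ℝ} (hg : Measurable g) (k j : Fin p) :
    Measurable fun ω => Function.update (f ω) k (g ω) j := by
  by_cases h : j = k
  · subst h; simpa using hg
  · simpa [Function.update_of_ne h] using hf j

theorem MeasurableNode.left (hX : ∀ i j, Measurable fun ω => X ω i j) (hT : MeasurableNode T)
    (j : Fin p) (i : Fin n) : MeasurableNode fun ω => (T ω).left (X ω) j (X ω i j) where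
  cases k := by
    simp only [Node.left, Finset.mem_filter]
    exact (hT.cases k).inter (measurableSet_le (hX k j) (hX i j))
  lo := hT.lo
  hi := measurable_update_apply hT.hi (hX i j) j

theorem MeasurableNode.right (hX : ∀ i j, Measurable fun ω => X ω i j) (hT : MeasurableNode T)
    (j : Fin p) (i : Fin n) : MeasurableNode fun ω => (T ω).right (X ω) j (X ω i j) where
  cases k := by
    simp only [Node.right, Finset.mem_filter]
    exact (hT.cases k).inter (measurableSet_lt (hX i j) (hX k j))
  lo := measurable_update_apply hT.lo (hX i j) j
  hi := hT.hi

theorem measurable_card {A : Ω → Finset (Fin n)} (hA : ∀ i, MeasurableSet {ω | i ∈ A ω}) :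
    Measurable fun ω => ((A ω).card : ℝ) := by
  have : (fun ω => ((A ω).card : ℝ)) = fun ω => ∑ i, if i ∈ A ω then (1 : ℝ) else 0 := by
    funext ω; simp
  rw [this]
  exact Finset.measurable_sum _ fun i _ => Measurable.ite (hA i) measurable_const measurable_const

theorem measurableSet_large (θ : Tuning) (hX : ∀ i j, Measurable fun ω => X ω i j)
    (hT : MeasurableNode T) : MeasurableSet {ω | (T ω).Large θ (X ω)} := by
  have h1 : MeasurableSet {ω | (n : ℝ) ^ θ.δ ≤ ((T ω).cases.card : ℝ)} :=
    measurableSet_le measurable_const (measurable_card hT.cases)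
  have h2 : MeasurableSet {ω | ∀ j, 2 * θ.σ₀ ^ 2
      ≤ scov (T ω).cases (fun i => X ω i j) (fun i => X ω i j)} := by
    refine measurableSet_setOfPred.2 (Measurable.forall fun j => measurableSet_setOfPred.1 ?_)
    exact measurableSet_le measurable_const
      (measurable_scov hT.cases (fun i => hX i j) fun i => hX i j)
  have h3 : MeasurableSet {ω | θ.η ≤ (T ω).vol} :=
    measurableSet_le measurable_const
      (Finset.measurable_prod _ fun j _ => (hT.hi j).sub (hT.lo j))
  exact h1.inter (h2.inter h3)

theorem measurable_fit (hX : ∀ i j, Measurable fun ω => X ω i j) (hT : MeasurableNode T)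
    (hr : ∀ i, Measurable fun ω => r ω i) {x : Ω → Fin p → ℝ} (hx : ∀ j, Measurable fun ω => x ω j)
    (m : Model n p) : Measurable fun ω => m.fit (X ω) (T ω) (r ω) (x ω) := by
  rcases m with _ | j | ⟨j, i⟩ | ⟨j, i⟩
  · exact measurable_avg hT.cases hr
  · exact measurable_lsLine hT.cases (fun i => hX i j) hr (hx j)
  · exact Measurable.ite (measurableSet_le (hx j) (hX i j))
      (measurable_avg (hT.left hX j i).cases hr) (measurable_avg (hT.right hX j i).cases hr)
  · exact Measurable.ite (measurableSet_le (hx j) (hX i j))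
      (measurable_lsLine (hT.left hX j i).cases (fun i => hX i j) hr (hx j))
      (measurable_lsLine (hT.right hX j i).cases (fun i => hX i j) hr (hx j))

theorem measurable_sum_cases {A : Ω → Finset (Fin n)} {f : Ω → Fin n → ℝ}
    (hA : ∀ i, MeasurableSet {ω | i ∈ A ω}) (hf : ∀ i, Measurable fun ω => f ω i) :
    Measurable fun ω => ∑ i ∈ A ω, f ω i := by
  simp only [← card_mul_avg]
  exact (measurable_card hA).mul (measurable_avg hA hf)

theorem measurable_bic (α : ℝ) (hX : ∀ i j, Measurable fun ω => X ω i j) (hT : MeasurableNode T)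
    (hr : ∀ i, Measurable fun ω => r ω i) (m : Model n p) :
    Measurable fun ω => m.bic α (X ω) (T ω) (r ω) := by
  have hrss : Measurable fun ω => m.rss (X ω) (T ω) (r ω) :=
    measurable_sum_cases hT.cases fun i =>
      ((hr i).sub (measurable_fit hX hT hr (hX i) m)).pow_const 2
  have hc := measurable_card hT.cases
  refine Measurable.ite (hrss (measurableSet_singleton 0)) measurable_const ?_
  refine measurable_coe_real_ereal.comp ?_
  exact (hc.mul (Real.measurable_log.comp (hrss.div hc))).add
    (measurable_const.mul (Real.measurable_log.comp hc))

theorem measurableSet_mem_best (θ : Tuning) (S : Finset (Fin p))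
    (hX : ∀ i j, Measurable fun ω => X ω i j) (hT : MeasurableNode T)
    (hr : ∀ i, Measurable fun ω => r ω i) (m : Model n p) :
    MeasurableSet {ω | m ∈ Model.best θ (X ω) S (T ω) (r ω)} := by
  have hall : ∀ m : Model n p, MeasurableSet {ω | m.Allowed θ (X ω) S (T ω)} := by
    have hsplit : ∀ j i, MeasurableSet {ω | j ∈ S ∧ i ∈ (T ω).cases ∧ (T ω).Large θ (X ω) ∧
        ((T ω).left (X ω) j (X ω i j)).Large θ (X ω) ∧
        ((T ω).right (X ω) j (X ω i j)).Large θ (X ω)} := fun j i =>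
      (MeasurableSet.const _).inter ((hT.cases i).inter ((measurableSet_large θ hX hT).inter
        ((measurableSet_large θ hX (hT.left hX j i)).inter
          (measurableSet_large θ hX (hT.right hX j i)))))
    rintro (_ | j | ⟨j, i⟩ | ⟨j, i⟩)
    · exact MeasurableSet.const _
    · exact MeasurableSet.const _
    · exact hsplit j i
    · exact hsplit j i
  refine (hall m).inter (measurableSet_setOfPred.2 (Measurable.forall fun m' =>
    Measurable.imp (measurableSet_setOfPred.1 (hall m')) (measurableSet_setOfPred.1 ?_)))
  exact measurableSet_le (measurable_bic _ hX hT hr m) (measurable_bic _ hX hT hr m')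

/-- Since there are finitely many models, any tie-breaking rule is measurable. -/
theorem measurableSet_pick_eq (θ : Tuning) (pick : Set (Model n p) → Model n p)
    (S : Finset (Fin p)) (hX : ∀ i j, Measurable fun ω => X ω i j) (hT : MeasurableNode T)
    (hr : ∀ i, Measurable fun ω => r ω i) (m : Model n p) :
    MeasurableSet {ω | pick (Model.best θ (X ω) S (T ω) (r ω)) = m} := by
  have h : {ω | pick (Model.best θ (X ω) S (T ω) (r ω)) = m}
      = ⋃ s ∈ {s | pick s = m}, {ω | ∀ m', m' ∈ Model.best θ (X ω) S (T ω) (r ω) ↔ m' ∈ s} := by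
    ext ω
    simp only [Set.mem_ofPred_eq, Set.mem_iUnion]
    constructor
    · intro h
      exact ⟨_, h, fun m' => Iff.rfl⟩
    · rintro ⟨s, hs, h⟩
      rw [Set.ext h]; exact hs
  rw [h]
  refine MeasurableSet.biUnion (Set.toFinite _).countable fun s _ => ?_
  refine measurableSet_setOfPred.2 (Measurable.forall fun m' => ?_)
  exact Measurable.iff (measurableSet_setOfPred.1 (measurableSet_mem_best θ S hX hT hr m'))
    measurable_const

theorem measurable_of_finite_cases {M : Type*} [Finite M] {m : Ω → M}
    (hm : ∀ a, MeasurableSet {ω | m ω = a}) {F : M → Ω → ℝ} (hF : ∀ a, Measurable (F a)) :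
    Measurable fun ω => F (m ω) ω := by
  have := Fintype.ofFinite M
  have h : (fun ω => F (m ω) ω) = fun ω => ∑ a, if m ω = a then F a ω else 0 := by
    funext ω; simp
  rw [h]
  exact Finset.measurable_sum _ fun a _ => Measurable.ite (hm a) (hF a) measurable_const

theorem measurable_grow (θ : Tuning) (pick : Set (Model n p) → Model n p)
    (hX : ∀ i j, Measurable fun ω => X ω i j) :
    ∀ (K : ℕ) (d : Draw p q K) (T : Ω → Node n p) (_ : MeasurableNode T) (r : Ω → Fin n → ℝ)
      (_ : ∀ i, Measurable fun ω => r ω i) (x : Ω → Fin p → ℝ) (_ : ∀ j, Measurable fun ω => x ω j),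
      Measurable fun ω => grow θ pick (X ω) K (T ω) (r ω) d (x ω)
  | 0, _, _, _, _, _, _, _ => measurable_const
  | K + 1, (S, dl, dr), T, hT, r, hr, x, hx => by
    have IH := measurable_grow θ pick hX K
    set F : Model n p → Ω → ℝ := fun m ω => m.fit (X ω) (T ω) (r ω) (x ω) +
      match m with
      | .con | .lin _ => grow θ pick (X ω) K (T ω)
          (fun i => r ω i - m.fit (X ω) (T ω) (r ω) (X ω i)) dl (x ω)
      | .pcon j i | .plin j i =>
          if x ω j ≤ X ω i j then grow θ pick (X ω) K ((T ω).left (X ω) j (X ω i j))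
            (fun i => r ω i - m.fit (X ω) (T ω) (r ω) (X ω i)) dl (x ω)
          else grow θ pick (X ω) K ((T ω).right (X ω) j (X ω i j))
            (fun i => r ω i - m.fit (X ω) (T ω) (r ω) (X ω i)) dr (x ω) with hF
    have hgrow : (fun ω => grow θ pick (X ω) (K + 1) (T ω) (r ω) (S, dl, dr) (x ω))
        = fun ω => F (pick (Model.best θ (X ω) S.1 (T ω) (r ω))) ω := by
      funext ω
      rcases hm : pick (Model.best θ (X ω) S.1 (T ω) (r ω)) with _ | j | ⟨j, i⟩ | ⟨j, i⟩ <;>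
        simp only [grow, hm, hF]
    rw [hgrow]
    refine measurable_of_finite_cases (measurableSet_pick_eq θ pick S.1 hX hT hr) fun m => ?_
    refine (measurable_fit hX hT hr hx m).add ?_
    have hr' : ∀ i, Measurable fun ω => r ω i - m.fit (X ω) (T ω) (r ω) (X ω i) := fun i =>
      (hr i).sub (measurable_fit hX hT hr (hX i) m)
    rcases m with _ | j | ⟨j, i⟩ | ⟨j, i⟩
    · exact IH dl T hT _ hr' x hx
    · exact IH dl T hT _ hr' x hx
    · exact Measurable.ite (measurableSet_le (hx j) (hX i j))
        (IH dl _ (hT.left hX j i) _ hr' x hx) (IH dr _ (hT.right hX j i) _ hr' x hx)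
    · exact Measurable.ite (measurableSet_le (hx j) (hX i j))
        (IH dl _ (hT.left hX j i) _ hr' x hx) (IH dr _ (hT.right hX j i) _ hr' x hx)

theorem measurableNode_root : MeasurableNode fun _ : Ω => Node.root n p where
  cases _ := MeasurableSet.const _
  lo _ := measurable_const
  hi _ := measurable_const

theorem measurable_treeLoss (θ : Tuning) (pick : Set (Model n p) → Model n p)
    (hX : ∀ i j, Measurable fun ω => X ω i j) {Y : Ω → Fin n → ℝ}
    (hY : ∀ i, Measurable fun ω => Y ω i) (K : ℕ) (d : Draw p q K) :
    Measurable fun ω => treeLoss θ pick (X ω) (Y ω) K d := by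
  have hbar : Measurable fun ω => avg Finset.univ (Y ω) :=
    measurable_avg (fun _ => MeasurableSet.const _) hY
  refine measurable_avg (fun _ => MeasurableSet.const _) fun i => ((hY i).sub ?_).pow_const 2
  exact hbar.add (measurable_grow θ pick hX K d _ measurableNode_root _
    (fun i => (hY i).sub hbar) _ (hX i))

end Measurability

/-! ### Elementary bounds for the training losses -/

section Losses

variable {n p q : ℕ}

theorem bddBelow_lsLoss (X : Fin n → Fin p → ℝ) (Y : Fin n → ℝ) :
    BddBelow (Set.range fun b : ℝ × (Fin p → ℝ) =>
      avg Finset.univ (fun i => (Y i - (b.1 + ∑ j, b.2 j * X i j)) ^ 2)) :=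
  ⟨0, by rintro _ ⟨b, rfl⟩; exact avg_nonneg fun _ _ => sq_nonneg _⟩

theorem lsLoss_nonneg (X : Fin n → Fin p → ℝ) (Y : Fin n → ℝ) : 0 ≤ lsLoss X Y :=
  Real.iInf_nonneg fun _ => avg_nonneg fun _ _ => sq_nonneg _

/-- An infimum of continuous functions of the data is upper semicontinuous. -/
theorem measurable_lsLoss_uncurry :
    Measurable fun z : (Fin n → Fin p → ℝ) × (Fin n → ℝ) => lsLoss z.1 z.2 := by
  have hcont : ∀ b : ℝ × (Fin p → ℝ), Continuous fun z : (Fin n → Fin p → ℝ) × (Fin n → ℝ) =>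
      avg Finset.univ (fun i => (z.2 i - (b.1 + ∑ j, b.2 j * z.1 i j)) ^ 2) := by
    intro b
    unfold avg
    fun_prop
  have h : UpperSemicontinuous fun z : (Fin n → Fin p → ℝ) × (Fin n → ℝ) =>
      ⨅ b : ℝ × (Fin p → ℝ),
        avg Finset.univ (fun i => (z.2 i - (b.1 + ∑ j, b.2 j * z.1 i j)) ^ 2) :=
    upperSemicontinuous_ciInf (fun z => bddBelow_lsLoss z.1 z.2)
      fun b => (hcont b).upperSemicontinuous
  exact h.measurable

theorem measurable_lsLoss {Ω : Type*} [MeasurableSpace Ω] {X : Ω → Fin n → Fin p → ℝ}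
    {Y : Ω → Fin n → ℝ} (hX : Measurable X) (hY : Measurable Y) :
    Measurable fun ω => lsLoss (X ω) (Y ω) :=
  Measurable.comp (g := fun z : (Fin n → Fin p → ℝ) × (Fin n → ℝ) => lsLoss z.1 z.2)
    (f := fun ω => (X ω, Y ω)) measurable_lsLoss_uncurry (hX.prodMk hY)

theorem treeLoss_eq (θ : Tuning) (pick : Set (Model n p) → Model n p) (X : Fin n → Fin p → ℝ)
    (Y : Fin n → ℝ) (K : ℕ) (d : Draw p q K) :
    treeLoss θ pick X Y K d
      = sse θ pick X K (Node.root n p) (fun i => Y i - avg Finset.univ Y) d / n := by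
  simp only [treeLoss, predict, avg, sse, Node.root, sub_add_eq_sub_sub, Finset.card_univ,
    Fintype.card_fin]

/-- Mean squared deviation from the average: the loss of the tree of depth `0`. -/
noncomputable def constLoss (Y : Fin n → ℝ) : ℝ :=
  avg Finset.univ fun i => (Y i - avg Finset.univ Y) ^ 2

theorem constLoss_eq (Y : Fin n → ℝ) :
    constLoss Y = (∑ i, (Y i - avg Finset.univ Y) ^ 2) / n := by
  simp [constLoss, avg]

theorem treeLoss_zero (θ : Tuning) (pick : Set (Model n p) → Model n p) (X : Fin n → Fin p → ℝ)
    (Y : Fin n → ℝ) (d : Draw p q 0) : treeLoss θ pick X Y 0 d = constLoss Y := by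
  rw [treeLoss_eq, sse_zero, constLoss_eq]; rfl

theorem treeLoss_le (θ : Tuning) (pick : Set (Model n p) → Model n p) (X : Fin n → Fin p → ℝ)
    (Y : Fin n → ℝ) (K : ℕ) (d : Draw p q K) : treeLoss θ pick X Y K d ≤ constLoss Y := by
  rw [treeLoss_eq, constLoss_eq]
  exact div_le_div_of_nonneg_right (sse_le _ _ _ _) (Nat.cast_nonneg _)

theorem treeLoss_nonneg (θ : Tuning) (pick : Set (Model n p) → Model n p)
    (X : Fin n → Fin p → ℝ) (Y : Fin n → ℝ) (K : ℕ) (d : Draw p q K) :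
    0 ≤ treeLoss θ pick X Y K d :=
  avg_nonneg fun _ _ => sq_nonneg _

theorem lsLoss_le_constLoss (X : Fin n → Fin p → ℝ) (Y : Fin n → ℝ) :
    lsLoss X Y ≤ constLoss Y := by
  refine (ciInf_le (bddBelow_lsLoss X Y) (avg Finset.univ Y, 0)).trans_eq ?_
  simp [constLoss]

theorem constLoss_le (Y : Fin n → ℝ) : constLoss Y ≤ avg Finset.univ fun i => Y i ^ 2 :=
  div_le_div_of_nonneg_right (sum_sub_avg_sq_le _ _) (Nat.cast_nonneg _)

/-- Contraction towards the least squares loss, for samples in which all possible nodes are well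
conditioned. -/
theorem drawMean_treeLoss_sub_le {θ : Tuning} {pick : Set (Model n p) → Model n p}
    (hp : 1 ≤ p) (hq : 1 ≤ q) (hqp : q ≤ p)
    (hpick : ∀ s : Set (Model n p), s.Nonempty → pick s ∈ s)
    (hα₀ : 0 ≤ θ.α) (hα₁ : θ.α ≤ 1) {κ κ' e : ℝ} (hκ : 0 < κ) (hκ1 : κ ≤ 1) (hκ' : 0 < κ')
    (hκ'1 : κ' ≤ 1) (hκκ : p * κ' ≤ κ) (he0 : 0 ≤ e) {X : Fin n → Fin p → ℝ} (Y : Fin n → ℝ)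
    (hgood : ∀ T : Node n p, Reached θ X T → T.cases.Nonempty ∧
      WellConditioned T.cases (fun j i => X i j) κ ∧
      2 * (Real.log T.cases.card / T.cases.card) ≤ e) (K : ℕ) :
    drawMean (fun d : Draw p q K => treeLoss θ pick X Y K d - lsLoss X Y)
      ≤ (1 - κ') ^ K * (constLoss Y - lsLoss X Y) + e / κ' * constLoss Y := by
  set c := (1 - κ') ^ K with hc
  have hc1 : c ≤ 1 := pow_le_one₀ (by linarith) (by linarith)
  have hgeom : ∑ k ∈ Finset.range K, (1 - κ') ^ k ≤ 1 / κ' := by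
    have h1 := mul_neg_geom_sum (1 - κ') K
    rw [le_div_iff₀ hκ']
    have h2 : 0 ≤ c := pow_nonneg (by linarith) _
    have h3 : (1 : ℝ) - (1 - κ') = κ' := by ring
    rw [h3] at h1
    linarith
  have hL0 : 0 ≤ constLoss Y := avg_nonneg fun _ _ => sq_nonneg _
  have hall : ∀ b : ℝ × (Fin p → ℝ),
      drawMean (fun d : Draw p q K => treeLoss θ pick X Y K d) - c * constLoss Y
        - e / κ' * constLoss Y
        ≤ (1 - c) * avg Finset.univ (fun i => (Y i - (b.1 + ∑ j, b.2 j * X i j)) ^ 2) := by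
    intro b
    set z : Fin n → ℝ := fun i => Y i - (b.1 + ∑ j, b.2 j * X i j) with hz
    have h := drawMean_sse_sub_le (q := q) hp hq hqp hpick hα₀ hα₁ hκ hκ1 hκ'.le hκ'1 hκκ he0
      hgood z K _ .root (fun i => Y i - avg Finset.univ Y)
      ⟨b.1 - avg Finset.univ Y, b.2, fun i _ => by simp only [hz]; ring⟩
    have h' := div_le_div_of_nonneg_right h (Nat.cast_nonneg n : (0 : ℝ) ≤ n)
    have e1 : avg Finset.univ (fun i => z i ^ 2) = (∑ i ∈ (Node.root n p).cases, z i ^ 2) / n := by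
      simp [avg, Node.root]
    have e2 : constLoss Y
        = (∑ i ∈ (Node.root n p).cases, (Y i - avg Finset.univ Y) ^ 2) / n := by
      rw [constLoss_eq]; rfl
    have e3 : e * (∑ k ∈ Finset.range K, (1 - κ') ^ k) * constLoss Y
        ≤ e / κ' * constLoss Y := by
      refine mul_le_mul_of_nonneg_right ?_ hL0
      calc _ ≤ e * (1 / κ') := mul_le_mul_of_nonneg_left hgeom he0
        _ = _ := by ring
    simp only [treeLoss_eq, drawMean_div]
    rw [sub_div, add_div, mul_div_assoc, mul_div_assoc, sub_div, ← e1, ← e2] at h'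
    linarith
  rw [drawMean_sub_const hqp]
  have hinf : drawMean (fun d : Draw p q K => treeLoss θ pick X Y K d) - c * constLoss Y
      - e / κ' * constLoss Y ≤ (1 - c) * lsLoss X Y := by
    rw [lsLoss, Real.mul_iInf_of_nonneg (by linarith)]
    exact le_ciInf hall
  linarith

end Losses

/-! ### Nodes of typical samples -/

section Typical

variable {n p : ℕ}

theorem box_none (x : Fin n → Fin p → ℝ) :
    box x (fun _ => none) (fun _ => none) = Set.Icc 0 1 := by
  ext y
  simp only [mem_box, Set.mem_Icc, Pi.le_def]
  constructor
  · exact fun h => ⟨fun j => (h j).1.1, fun j => (h j).1.2⟩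
  · exact fun h j => ⟨⟨h.1 j, h.2 j⟩, by simp, by simp⟩

/-- In a sample that is uniformly close to the population, every node that a tree can reach
inherits the eigenvalue bound. The variances are bounded below by the rules of the tree, except in
the root, where the population variances do. -/
theorem wellConditioned_of_reached {θ : Tuning} {P : Measure (Fin p → ℝ)} [IsProbabilityMeasure P]
    (hη₁ : θ.η ≤ 1) (hδ₁ : θ.δ < 1) {l v τ : ℝ} (hl : 0 < l)
    (hcor : CorBounded P θ.η l) (hv : 0 < v) (hvσ : v ≤ 2 * θ.σ₀ ^ 2)
    (hvP : ∀ j, 2 * v ≤ cov[fun y => y j, fun y => y j; P[|Set.Icc 0 1]])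
    (hp : 1 ≤ p) (hτ : (2 * l + p) * (3 * τ) ≤ l * v) (hτ0 : 0 ≤ τ) (hτ1 : τ < 1)
    (hn : 1 ≤ n) {X : Fin n → Fin p → ℝ} (hX : ∀ i, X i ∈ Set.Icc 0 1)
    (hclose : UniformlyClose P ((n : ℝ) ^ θ.δ) τ X) {T : Node n p} (hT : Reached θ X T) :
    T.cases.Nonempty ∧ WellConditioned T.cases (fun j i => X i j) l ∧
      2 * (Real.log T.cases.card / T.cases.card) ≤ 2 * (Real.log n / (n : ℝ) ^ θ.δ) := by
  have hn1 : (1 : ℝ) ≤ n := by exact_mod_cast hn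
  have hroot : T = Node.root n p ∨ T.Large θ X := by
    cases hT with
    | root => exact Or.inl rfl
    | left hT j hi hL => exact Or.inr hL
    | right hT j hi hL => exact Or.inr hL
  have hcard : (n : ℝ) ^ θ.δ ≤ T.cases.card := by
    rcases hroot with rfl | h
    · have : (n : ℝ) ^ θ.δ ≤ (n : ℝ) ^ (1 : ℝ) :=
        Real.rpow_le_rpow_of_exponent_le hn1 hδ₁.le
      simpa [Node.root] using this
    · exact h.1
  have hpow : 0 < (n : ℝ) ^ θ.δ := by positivity
  have hne : T.cases.Nonempty := by
    rw [← Finset.card_pos]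
    exact_mod_cast hpow.trans_le hcard
  have hvol : θ.η ≤ T.vol := by
    rcases hroot with rfl | h
    · simpa [Node.vol, Node.root] using hη₁
    · exact h.2.2
  have hcard0 : (0 : ℝ) < T.cases.card := hpow.trans_le hcard
  refine ⟨hne, ?_, ?_⟩
  · obtain ⟨a, b, hbox, hex⟩ : ∃ a b, IsBox X T a b ∧ (T = Node.root n p →
        a = (fun _ => none) ∧ b = fun _ => none) := by
      rcases hroot with rfl | h
      · exact ⟨_, _, isBox_root hX, fun _ => ⟨rfl, rfl⟩⟩
      · by_cases hr : T = Node.root n p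
        · subst hr
          exact ⟨_, _, isBox_root hX, fun _ => ⟨rfl, rfl⟩⟩
        · obtain ⟨a, b, hab⟩ := hT.exists_isBox hX
          exact ⟨a, b, hab, fun h => absurd h hr⟩
    have hcases : boxCases X a b = T.cases := by
      ext i
      rw [hbox.1 i]
      simp [boxCases]
    have hdev : ∀ u, |avg T.cases (fun i => mon u (X i)) - cmean P (box X a b) u| ≤ τ := by
      intro u
      have h := hclose a b u (by rw [hcases]; exact hcard)
      rw [hcases, Finset.sum_sub_distrib, Finset.sum_const, nsmul_eq_mul, ← card_mul_avg,
        ← mul_sub, abs_mul, abs_of_pos hcard0, mul_comm] at h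
      exact le_of_mul_le_mul_right h hcard0
    -- A box of probability `0` has conditional means `0`, which the constant function detects.
    have hP : P (box X a b) ≠ 0 := by
      intro h0
      have h := hdev (none, none)
      have h1 : cmean P (box X a b) (none, none) = 0 := by
        rw [cmean, cond_eq_zero_of_meas_eq_zero h0]; simp
      rw [h1] at h
      simp only [mon, Option.elim_none, mul_one, avg_const hne, sub_zero,
        abs_one] at h
      linarith
    have hC := hcor (side X a b) (ordConnected_side X a b) (box_subset X a b)
      (by rw [show Set.univ.pi (side X a b) = box X a b from rfl, hbox.volume_real hX hne]
          exact hvol) hP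
    refine wellConditioned_of_close (measurableSet_box X a b) (box_subset X a b) hP hl hC hne
      (fun i _ => hX i) hv hτ hdev ?_
    rcases hroot with h | h
    · right
      intro j
      obtain ⟨rfl, rfl⟩ := hex h
      rw [box_none]
      refine ⟨hvP j, ?_⟩
      have hp' : (1 : ℝ) ≤ p := by exact_mod_cast hp
      nlinarith
    · exact Or.inl fun j => hvσ.trans (h.2.1 j)
  · have hle : (T.cases.card : ℝ) ≤ n := by
      have := Finset.card_le_univ T.cases
      rw [Fintype.card_fin] at this
      exact_mod_cast this
    have h1 : Real.log T.cases.card ≤ Real.log n := Real.log_le_log hcard0 hle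
    have h2 : 0 ≤ Real.log n := Real.log_nonneg hn1
    have := div_le_div₀ h2 h1 hpow hcard
    linarith

/-- The cube itself shows that `2 * l ≤ 1` and that all predictors have positive variance. -/
theorem CorBounded.exists_variance_bound {P : Measure (Fin p → ℝ)} [IsProbabilityMeasure P]
    {η l : ℝ} (hcor : CorBounded P η l) (hp : 1 ≤ p) (hη₁ : η ≤ 1) (hl : 0 < l)
    (hP : P (Set.Icc 0 1) = 1) {s : ℝ} (hs : 0 < s) :
    2 * l ≤ 1 ∧ ∃ v : ℝ, 0 < v ∧ v ≤ s ∧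
      ∀ j, 2 * v ≤ cov[fun y => y j, fun y => y j; P[|Set.Icc 0 1]] := by
  have hPC : P (Set.Icc 0 1) ≠ 0 := by rw [hP]; exact one_ne_zero
  have hroot : (corMatrix P[|Set.Icc 0 1]
      - (2 * l) • (1 : Matrix (Fin p) (Fin p) ℝ)).PosSemidef := by
    have hset : Set.univ.pi (fun _ : Fin p => Set.Icc (0 : ℝ) 1) = Set.Icc 0 1 :=
      Set.pi_univ_Icc 0 1
    have h := hcor (fun _ => Set.Icc 0 1) (fun _ => Set.ordConnected_Icc) hset.subset
      (by rw [Measure.real, volume_pi_pi]; simpa using hη₁) (by rwa [hset])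
    rwa [hset] at h
  have := cond_isProbabilityMeasure hPC
  obtain ⟨hvarpos, hl2, -⟩ := cov_form_of_posSemidef P[|Set.Icc 0 1]
    (memLp_coord measurableSet_Icc subset_rfl) hl hroot
  refine ⟨hl2 ⟨0, hp⟩, ?_⟩
  have : Nonempty (Fin p) := ⟨⟨0, hp⟩⟩
  obtain ⟨j₀, hj₀⟩ := Finite.exists_min fun j : Fin p =>
    cov[fun y => y j, fun y => y j; P[|Set.Icc 0 1]]
  refine ⟨min s (cov[fun y => y j₀, fun y => y j₀; P[|Set.Icc 0 1]] / 2),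
    lt_min hs (half_pos (hvarpos j₀)), min_le_left _ _, fun j => ?_⟩
  have := min_le_right s (cov[fun y => y j₀, fun y => y j₀; P[|Set.Icc 0 1]] / 2)
  linarith [hj₀ j]

/-- The probability of an atypical sample decays faster than `n ^ (-2)`. -/
theorem exists_measure_not_uniformlyClose_le {P : Measure (Fin p → ℝ)} [IsProbabilityMeasure P]
    {δ τ : ℝ} (hδ : 0 < δ) (hτ0 : 0 < τ) (hτ1 : τ ≤ 1) :
    ∃ D : ℝ, 0 ≤ D ∧ ∀ n : ℕ, 1 ≤ n →
      (Measure.pi fun _ : Fin n => P) {x | ¬ UniformlyClose P ((n : ℝ) ^ δ) τ x}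
        ≤ ENNReal.ofReal (D / (n : ℝ) ^ 2) := by
  obtain ⟨D, hD0, hD⟩ := exists_pow_mul_exp_neg_le hδ (by positivity : 0 < τ ^ 2 / 4) (2 * p + 2)
  refine ⟨2 * (p + 1) ^ 2 * (2 ^ p) ^ 2 * Real.exp (p * τ) * D, by positivity, fun n hn => ?_⟩
  refine (measure_not_uniformlyClose_le hτ0.le hτ1 _).trans (ENNReal.ofReal_le_ofReal ?_)
  have hn1 : (1 : ℝ) ≤ n := by exact_mod_cast hn
  have h1 : ((n + 1 : ℝ) ^ p) ^ 2 ≤ ((2 * n : ℝ) ^ p) ^ 2 := by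
    gcongr; linarith
  rw [le_div_iff₀ (by positivity)]
  have h2 := hD n hn
  set E := Real.exp (-(τ ^ 2 / 4 * (n : ℝ) ^ δ)) with hE
  have hE0 : 0 < E := Real.exp_pos _
  calc 2 * (p + 1 : ℝ) ^ 2 * ((n + 1) ^ p) ^ 2 * (Real.exp (p * τ) * E) * n ^ 2
      ≤ 2 * (p + 1 : ℝ) ^ 2 * ((2 * n) ^ p) ^ 2 * (Real.exp (p * τ) * E) * n ^ 2 := by gcongr
    _ = 2 * (p + 1) ^ 2 * (2 ^ p) ^ 2 * Real.exp (p * τ) * (n ^ (2 * p + 2) * E) := by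
        rw [mul_pow]; ring
    _ ≤ _ := by gcongr

end Typical

/-! ### Integration over the sample -/

section Integration

variable {Ω : Type*} [MeasurableSpace Ω] {μ : Measure Ω}

theorem integrable_avg {n : ℕ} {f : ℕ → Ω → ℝ} (hf : ∀ i, Integrable (f i) μ) :
    Integrable (fun ω => avg Finset.univ fun i : Fin n => f i ω) μ :=
  (integrable_finsetSum (f := fun (i : Fin n) => f i) Finset.univ fun i _ => hf i).div_const _

theorem integral_avg {n : ℕ} (hn : 1 ≤ n) {f : ℕ → Ω → ℝ} (hf : ∀ i, Integrable (f i) μ)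
    (hid : ∀ i, ∫ ω, f i ω ∂μ = ∫ ω, f 0 ω ∂μ) :
    ∫ ω, (avg Finset.univ fun i : Fin n => f i ω) ∂μ = ∫ ω, f 0 ω ∂μ := by
  have hn0 : (n : ℝ) ≠ 0 := by positivity
  simp only [avg]
  rw [integral_div, integral_finsetSum (f := fun (i : Fin n) => f i) Finset.univ fun i _ => hf i, Finset.sum_congr rfl fun (i : Fin n) _ => hid i]
  simp
  field_simp

theorem avg_sq_sq_le {n : ℕ} (hn : 1 ≤ n) (y : Fin n → ℝ) :
    (avg Finset.univ fun i => y i ^ 2) ^ 2 ≤ avg Finset.univ fun i => y i ^ 4 := by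
  have hn0 : (0 : ℝ) < n := by exact_mod_cast hn
  have h := sq_sum_le_card_mul_sum_sq (s := Finset.univ) (f := fun i => y i ^ 2)
  simp only [Finset.card_univ, Fintype.card_fin, ← pow_mul] at h
  simp only [avg, Finset.card_univ, Fintype.card_fin, div_pow]
  rw [div_le_div_iff₀ (by positivity) hn0]
  calc (∑ i, y i ^ 2) ^ 2 * n ≤ (n * ∑ i, y i ^ (2 * 2)) * n :=
        mul_le_mul_of_nonneg_right h hn0.le
    _ = _ := by ring

theorem integral_le_sqrt [IsProbabilityMeasure μ] {Z : Ω → ℝ} (hZ : MemLp Z 2 μ) : ∫ ω, Z ω ∂μ ≤ √(∫ ω, Z ω ^ 2 ∂μ) := by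
  have h := variance_nonneg Z μ
  rw [variance_eq_sub hZ] at h
  refine (le_abs_self _).trans (Real.abs_le_sqrt ?_)
  simp only [Pi.pow_apply] at h
  linarith

/-- The response has a finite fourth moment, since the predictors are bounded. -/
theorem memLp_response [IsProbabilityMeasure μ] {p : ℕ} {X : Ω → Fin p → ℝ} {ε : Ω → ℝ} (hX : Measurable X)
    (hcube : ∀ᵐ ω ∂μ, X ω ∈ Set.Icc (0 : Fin p → ℝ) 1) (hmom : MemLp ε 4 μ) (β₀ : ℝ)
    (β : Fin p → ℝ) : MemLp (fun ω => β₀ + ∑ j, β j * X ω j + ε ω) 4 μ := by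
  refine MemLp.add ((memLp_const β₀).add ?_) hmom
  refine memLp_finsetSum _ fun j _ => MemLp.const_mul ?_ _
  refine MemLp.of_bound ((measurable_pi_apply j).comp hX).aestronglyMeasurable 1 ?_
  filter_upwards [hcube] with ω hω
  rw [Real.norm_eq_abs, abs_of_nonneg (hω.1 j)]
  exact hω.2 j

/-- A bound that holds outside of a set `B` of small probability, integrated. On `B` the crude bound
`Q` is split by `Q ≤ Q ^ 2 / (2 * b) + b / 2`. -/
theorem integral_le_of_bound_off [IsProbabilityMeasure μ] {G Z Q W : Ω → ℝ} {B : Set Ω}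
    (hG : Integrable G μ) (hZ : MemLp Z 2 μ) (hQ : Integrable Q μ) (hW : Integrable W μ)
    (hB : MeasurableSet B) (hZ0 : ∀ ω, 0 ≤ Z ω) (hQ0 : ∀ ω, 0 ≤ Q ω) (hQW : ∀ ω, Q ω ^ 2 ≤ W ω)
    (hGQ : ∀ ω, G ω ≤ Q ω) {c a b : ℝ} (hc : 0 ≤ c) (ha : 0 ≤ a) (hb : 0 < b)
    (h : ∀ᵐ ω ∂μ, ω ∉ B → G ω ≤ c * Z ω + a * Q ω) :
    ∫ ω, G ω ∂μ ≤ c * √(∫ ω, Z ω ^ 2 ∂μ)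
      + (a * ∫ ω, Q ω ∂μ + (1 / (2 * b) * ∫ ω, W ω ∂μ + b / 2 * μ.real B)) := by
  have hpt : ∀ᵐ ω ∂μ, G ω ≤ (c * Z ω + a * Q ω)
      + (1 / (2 * b) * W ω + b / 2 * B.indicator (fun _ => (1 : ℝ)) ω) := by
    filter_upwards [h] with ω hω
    have h1 : 1 / (2 * b) * Q ω ^ 2 ≤ 1 / (2 * b) * W ω :=
      mul_le_mul_of_nonneg_left (hQW ω) (by positivity)
    by_cases hωB : ω ∈ B
    · rw [Set.indicator_of_mem hωB]
      have h2 : 1 / (2 * b) * Q ω ^ 2 + b / 2 * 1 - Q ω = (Q ω - b) ^ 2 / (2 * b) := by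
        field_simp; ring
      have h3 : 0 ≤ (Q ω - b) ^ 2 / (2 * b) := by positivity
      have h4 := mul_nonneg hc (hZ0 ω)
      have h5 := mul_nonneg ha (hQ0 ω)
      linarith [hGQ ω]
    · rw [Set.indicator_of_notMem hωB]
      have h6 : 0 ≤ 1 / (2 * b) * Q ω ^ 2 := by positivity
      linarith [hω hωB]
  have hind : Integrable (B.indicator fun _ => (1 : ℝ)) μ := (integrable_const 1).indicator hB
  have h₁ : Integrable (fun ω => c * Z ω) μ := (hZ.integrable one_le_two).const_mul _
  have h₂ : Integrable (fun ω => a * Q ω) μ := hQ.const_mul _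
  have h₃ : Integrable (fun ω => 1 / (2 * b) * W ω) μ := hW.const_mul _
  have h₄ : Integrable (fun ω => b / 2 * B.indicator (fun _ => (1 : ℝ)) ω) μ := hind.const_mul _
  have h₁₂ : Integrable (fun ω => c * Z ω + a * Q ω) μ := h₁.add h₂
  have h₃₄ : Integrable (fun ω => 1 / (2 * b) * W ω
      + b / 2 * B.indicator (fun _ => (1 : ℝ)) ω) μ := h₃.add h₄
  have hmain := integral_mono_ae hG (h₁₂.add h₃₄) hpt
  simp only [Pi.add_apply] at hmain
  rw [integral_add h₁₂ h₃₄, integral_add h₁ h₂, integral_add h₃ h₄, integral_const_mul,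
    integral_const_mul, integral_const_mul, integral_const_mul, integral_indicator_const _ hB,
    smul_eq_mul, mul_one] at hmain
  have := mul_le_mul_of_nonneg_left (integral_le_sqrt hZ) hc
  linarith

/-- Both the fourth moment and the probability of atypical samples contribute a term of the order
of `n ^ (-δ)`. -/
theorem remainder_le {n : ℕ} (hn : 2 ≤ n) {δ M₂ M₄ D κ b : ℝ} (hδ₁ : δ < 1) (hM₄ : 0 ≤ M₄)
    (hD : 0 ≤ D) (hb : b ≤ D / (n : ℝ) ^ 2) :
    2 * (Real.log n / (n : ℝ) ^ δ) / κ * M₂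
        + (1 / (2 * (n : ℝ) ^ δ) * M₄ + (n : ℝ) ^ δ / 2 * b)
      ≤ (2 / κ * M₂ + (M₄ + D) / (2 * Real.log 2)) * (Real.log n / (n : ℝ) ^ δ) := by
  have hn2 : (2 : ℝ) ≤ n := by exact_mod_cast hn
  have hn1 : (1 : ℝ) ≤ n := by linarith
  have hlog2 : 0 < Real.log 2 := Real.log_pos (by norm_num)
  have hlog : Real.log 2 ≤ Real.log n := Real.log_le_log (by norm_num) hn2
  set m : ℝ := (n : ℝ) ^ δ with hm
  have hm0 : 0 < m := by positivity
  have h1 : m ^ 2 ≤ (n : ℝ) ^ 2 := by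
    refine pow_le_pow_left₀ hm0.le ?_ 2
    calc m ≤ (n : ℝ) ^ (1 : ℝ) := Real.rpow_le_rpow_of_exponent_le hn1 hδ₁.le
      _ = n := Real.rpow_one _
  have h2 : m / 2 * b ≤ 1 / (2 * m) * D := by
    have h3 : b ≤ D / m ^ 2 := hb.trans (div_le_div_of_nonneg_left hD (by positivity) h1)
    calc m / 2 * b ≤ m / 2 * (D / m ^ 2) := mul_le_mul_of_nonneg_left h3 (by positivity)
      _ = _ := by field_simp
  have h4 : 1 / (2 * m) * (M₄ + D) ≤ (M₄ + D) / (2 * Real.log 2) * (Real.log n / m) := by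
    have h5 : (M₄ + D) / (2 * Real.log 2) * (Real.log n / m)
        = 1 / (2 * m) * (M₄ + D) * (Real.log n / Real.log 2) := by field_simp
    rw [h5]
    exact le_mul_of_one_le_right (by positivity) ((one_le_div hlog2).2 hlog)
  have h6 : 2 * (Real.log n / m) / κ * M₂ = 2 / κ * M₂ * (Real.log n / m) := by ring
  rw [add_mul, ← h6]
  linarith

end Integration

end Pilot

open Pilot in
theorem theorem3 {Ω : Type*} [MeasurableSpace Ω] (μ : Measure Ω) [IsProbabilityMeasure μ]
    (p q : ℕ) (hq : 1 ≤ q) (hqp : q ≤ p)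
    (θ : Pilot.Tuning) (hα₀ : 0 ≤ θ.α) (hα₁ : θ.α ≤ 1) (hδ₀ : 0 < θ.δ) (hδ₁ : θ.δ < 1)
    (hσ₀ : 0 < θ.σ₀) (hσ₁ : θ.σ₀ < 1) (hη₀ : 0 < θ.η) (hη₁ : θ.η ≤ 1)
    (l₀ : ℝ) (hl₀ : 0 < l₀)
    -- the cases: independent and identically distributed predictor vectors and errors
    (X : ℕ → Ω → Fin p → ℝ) (ε : ℕ → Ω → ℝ)
    (hX : ∀ i, Measurable (X i)) (hε : ∀ i, Measurable (ε i))
    (hindep : iIndepFun (fun i ω => (X i ω, ε i ω)) μ)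
    (hident : ∀ i, IdentDistrib (fun ω => (X i ω, ε i ω)) (fun ω => (X 0 ω, ε 0 ω)) μ μ)
    (hcube : ∀ᵐ ω ∂μ, X 0 ω ∈ Set.Icc (0 : Fin p → ℝ) 1)
    (hmom : MemLp (ε 0) 4 μ)
    (hcor : Pilot.CorBounded (μ.map (X 0)) θ.η l₀)
    -- the linear model for the response
    (β₀ : ℝ) (β : Fin p → ℝ) (Y : ℕ → Ω → ℝ)
    (hY : ∀ i ω, Y i ω = β₀ + ∑ j, β j * X i ω j + ε i ω) :
    ∃ C : ℝ, ∀ n : ℕ, 2 ≤ n → ∀ K : ℕ,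
      ∀ pick : Set (Pilot.Model n p) → Pilot.Model n p, (∀ s, s.Nonempty → pick s ∈ s) →
        Integrable (fun ω => Pilot.drawMean fun d : Pilot.Draw p q K =>
          Pilot.treeLoss θ pick (fun i : Fin n => X i ω) (fun i => Y i ω) K d
            - Pilot.lsLoss (fun i : Fin n => X i ω) (fun i => Y i ω)) μ ∧
        ∫ ω, (Pilot.drawMean fun d : Pilot.Draw p q K =>
          Pilot.treeLoss θ pick (fun i : Fin n => X i ω) (fun i => Y i ω) K d
            - Pilot.lsLoss (fun i : Fin n => X i ω) (fun i => Y i ω)) ∂μ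
        ≤ (1 - (q : ℝ) * l₀ / (4 * (p : ℝ) ^ 2)) ^ K *
            √(∫ ω, (Pilot.drawMean fun d : Pilot.Draw p q 0 =>
              (Pilot.treeLoss θ pick (fun i : Fin n => X i ω) (fun i => Y i ω) 0 d
                - Pilot.lsLoss (fun i : Fin n => X i ω) (fun i => Y i ω)) ^ 2) ∂μ)
          + C * (Real.log n / (n : ℝ) ^ θ.δ) := by
  have hp : 1 ≤ p := hq.trans hqp
  have hp0 : (0 : ℝ) < p := by exact_mod_cast hp
  have hq0 : (0 : ℝ) < q := by exact_mod_cast hq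
  have hqp' : (q : ℝ) ≤ p := by exact_mod_cast hqp
  set P : Measure (Fin p → ℝ) := μ.map (X 0) with hP
  have hPprob : IsProbabilityMeasure P := Measure.isProbabilityMeasure_map (hX 0).aemeasurable
  have hcubeP : P (Set.Icc 0 1) = 1 := by
    rw [hP, Measure.map_apply (hX 0) measurableSet_Icc]
    exact (mem_ae_iff_prob_eq_one (hX 0 measurableSet_Icc)).1 hcube
  have hidX : ∀ i, IdentDistrib (X i) (X 0) μ μ := fun i => (hident i).comp measurable_fst
  have hlaw : ∀ n : ℕ, μ.map (fun ω (i : Fin n) => X i ω) = Measure.pi fun _ : Fin n => P := by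
    intro n
    have h1 : iIndepFun X μ := hindep.comp (fun _ => Prod.fst) fun _ => measurable_fst
    have h2 : iIndepFun (fun i : Fin n => X i) μ := h1.precomp Fin.val_injective
    rw [iIndepFun.map_fun_eq_pi_map (f := fun i : Fin n => X i)
      (fun i => (hX i).aemeasurable) h2]
    congr 1
    funext i
    exact (hidX i).map_eq
  have hcubeAll : ∀ᵐ ω ∂μ, ∀ i, X i ω ∈ Set.Icc (0 : Fin p → ℝ) 1 :=
    ae_all_iff.2 fun i => (hidX i).symm.ae_snd (p := fun x => x ∈ Set.Icc 0 1)
      measurableSet_Icc hcube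
  obtain ⟨hl2, v, hv, hvσ, hvP⟩ := hcor.exists_variance_bound hp hη₁ hl₀ hcubeP
    (by positivity : 0 < 2 * θ.σ₀ ^ 2)
  -- The largest tolerance for which `wellConditioned_of_close` gives the bound `l₀`.
  set τ : ℝ := l₀ * v / (3 * (2 * l₀ + p)) with hτdef
  have hτ0 : 0 < τ := by positivity
  have hτ : (2 * l₀ + p) * (3 * τ) ≤ l₀ * v := by
    rw [hτdef]; apply le_of_eq; field_simp
  have hτ1 : τ < 1 := by
    have h1 : (1 : ℝ) ≤ p := by exact_mod_cast hp
    nlinarith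
  obtain ⟨D, hD0, hD⟩ := exists_measure_not_uniformlyClose_le (P := P) hδ₀ hτ0 hτ1.le
  have hY4 : ∀ i, MemLp (Y i) 4 μ := by
    intro i
    have hiε : IdentDistrib (ε i) (ε 0) μ μ := (hident i).comp measurable_snd
    have h := memLp_response (hX i) (hcubeAll.mono fun ω h => h i)
      (hiε.memLp_iff.2 hmom) β₀ β
    rwa [← funext (hY i)] at h
  have hYm : ∀ i, Measurable (Y i) := by
    intro i
    rw [funext (hY i)]
    exact (measurable_const.add (Finset.measurable_sum _ fun j _ =>
      measurable_const.mul ((measurable_pi_apply j).comp (hX i)))).add (hε i)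
  have hYid : ∀ i, IdentDistrib (Y i) (Y 0) μ μ := by
    intro i
    have hφ : Measurable fun z : (Fin p → ℝ) × ℝ => β₀ + ∑ j, β j * z.1 j + z.2 := by fun_prop
    have h := (hident i).comp hφ
    rw [funext (hY i), funext (hY 0)]
    exact h
  have hint4 : ∀ i, Integrable (fun ω => Y i ω ^ 4) μ := by
    intro i
    have h := (hY4 i).integrable_norm_pow (by norm_num : (4 : ℕ) ≠ 0)
    refine h.congr (Filter.Eventually.of_forall fun ω => ?_)
    simp only [Real.norm_eq_abs]
    exact Even.pow_abs (by decide) _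
  have hint2 : ∀ i, Integrable (fun ω => Y i ω ^ 2) μ := fun i =>
    ((hY4 i).mono_exponent (by norm_num : (2 : ENNReal) ≤ 4)).integrable_sq
  have hE : ∀ k : ℕ, ∀ i, ∫ ω, Y i ω ^ k ∂μ = ∫ ω, Y 0 ω ^ k ∂μ := fun k i =>
    ((hYid i).comp (measurable_id.pow_const k)).integral_eq
  set M₂ := ∫ ω, Y 0 ω ^ 2 ∂μ with hM₂
  set M₄ := ∫ ω, Y 0 ω ^ 4 ∂μ with hM₄
  have hM₄0 : 0 ≤ M₄ := integral_nonneg fun ω => by positivity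
  set κ' : ℝ := q * l₀ / (4 * p ^ 2) with hκ'def
  have hκ'0 : 0 < κ' := by positivity
  have hκκ : p * κ' ≤ l₀ := by
    rw [hκ'def, mul_div_assoc', div_le_iff₀ (by positivity)]
    have h1 : q * l₀ * p ≤ p * l₀ * p := by gcongr
    nlinarith [mul_pos hl₀ (pow_pos hp0 2)]
  have hκ'1 : κ' ≤ 1 := by
    have h1 : (1 : ℝ) ≤ p := by exact_mod_cast hp
    nlinarith
  refine ⟨2 / κ' * M₂ + (M₄ + D) / (2 * Real.log 2), fun n hn K pick hpick => ?_⟩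
  have hn1 : 1 ≤ n := by omega
  have hnR : (1 : ℝ) ≤ n := by exact_mod_cast hn1
  set x : Ω → Fin n → Fin p → ℝ := fun ω i => X i ω with hx
  set y : Ω → Fin n → ℝ := fun ω i => Y i ω with hy
  have hxm : Measurable x := measurable_pi_lambda _ fun i => hX i
  have hym : Measurable y := measurable_pi_lambda _ fun i => hYm i
  have hxij : ∀ i j, Measurable fun ω => x ω i j := fun i j =>
    (measurable_pi_apply j).comp (hX i)
  have hyi : ∀ i, Measurable fun ω => y ω i := fun i => hYm i
  set nδ : ℝ := (n : ℝ) ^ θ.δ with hnδ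
  have hnδ0 : 0 < nδ := by positivity
  set Q : Ω → ℝ := fun ω => avg Finset.univ fun i => y ω i ^ 2 with hQ
  have hQ0 : ∀ ω, 0 ≤ Q ω := fun ω => avg_nonneg fun _ _ => sq_nonneg _
  have hQint : Integrable Q μ := integrable_avg hint2
  have hQ4int : Integrable (fun ω => avg Finset.univ fun i => y ω i ^ 4) μ := integrable_avg hint4
  have hQ4 : ∀ ω, Q ω ^ 2 ≤ avg Finset.univ fun i => y ω i ^ 4 := fun ω => avg_sq_sq_le hn1 _
  have hQint_eq : ∫ ω, Q ω ∂μ = M₂ := integral_avg hn1 hint2 (hE 2)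
  have hQ4int_eq : ∫ ω, (avg Finset.univ fun i => y ω i ^ 4) ∂μ = M₄ :=
    integral_avg hn1 hint4 (hE 4)
  set L : Ω → ℝ := fun ω => constLoss (y ω) with hL
  set R : Ω → ℝ := fun ω => lsLoss (x ω) (y ω) with hR
  have hLQ : ∀ ω, L ω ≤ Q ω := fun ω => constLoss_le _
  have hRL : ∀ ω, R ω ≤ L ω := fun ω => lsLoss_le_constLoss _ _
  have hR0 : ∀ ω, 0 ≤ R ω := fun ω => lsLoss_nonneg _ _
  have hRm : Measurable R := measurable_lsLoss hxm hym
  have hLm : Measurable L := by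
    have hbar : Measurable fun ω => avg Finset.univ (y ω) :=
      measurable_avg (fun _ => MeasurableSet.const _) hyi
    exact measurable_avg (fun _ => MeasurableSet.const _) fun i => ((hyi i).sub hbar).pow_const 2
  set G : Ω → ℝ := fun ω => drawMean fun d : Draw p q K => treeLoss θ pick (x ω) (y ω) K d - R ω
    with hG
  have hGm : Measurable G := by
    refine (Finset.measurable_sum _ fun d _ => ?_).div_const _
    exact (measurable_treeLoss θ pick hxij hyi K d).sub hRm
  have hG_le : ∀ ω, G ω ≤ L ω := fun ω =>
    (drawMean_mono fun d => by linarith [treeLoss_le θ pick (x ω) (y ω) K d, hR0 ω]).trans_eq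
      (drawMean_const hqp K _)
  have hG_ge : ∀ ω, -L ω ≤ G ω := fun ω =>
    (drawMean_const hqp K _).symm.trans_le
      (drawMean_mono fun d => by linarith [treeLoss_nonneg θ pick (x ω) (y ω) K d, hRL ω])
  have hGint : Integrable G μ := by
    refine hQint.mono' hGm.aestronglyMeasurable (Filter.Eventually.of_forall fun ω => ?_)
    rw [Real.norm_eq_abs]
    exact abs_le.2 ⟨by linarith [hG_ge ω, hLQ ω], (hG_le ω).trans (hLQ ω)⟩
  refine ⟨hGint, ?_⟩
  -- The exceptional event is enlarged to a measurable one.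
  set B : Set Ω := toMeasurable μ {ω | ¬ UniformlyClose P nδ τ (x ω)} with hB
  have hBm : MeasurableSet B := measurableSet_toMeasurable _ _
  have hBμ : μ.real B ≤ D / (n : ℝ) ^ 2 := by
    rw [Measure.real, hB, measure_toMeasurable]
    refine ENNReal.toReal_le_of_le_ofReal (by positivity) ?_
    have h1 := Measure.le_map_apply (μ := μ) hxm.aemeasurable {z | ¬ UniformlyClose P nδ τ z}
    rw [show μ.map x = Measure.pi fun _ : Fin n => P from hlaw n] at h1
    exact h1.trans (hD n hn1)
  set e : ℝ := 2 * (Real.log n / nδ) with he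
  have hlogn : 0 ≤ Real.log n := Real.log_nonneg hnR
  have he0 : 0 ≤ e := by positivity
  have hLR2 : MemLp (fun ω => L ω - R ω) 2 μ := by
    refine (memLp_two_iff_integrable_sq (f := fun ω => L ω - R ω)
      (hLm.sub hRm).aestronglyMeasurable).2 ?_
    refine hQ4int.mono' ((hLm.sub hRm).pow_const 2).aestronglyMeasurable
      (Filter.Eventually.of_forall fun ω => ?_)
    rw [Real.norm_eq_abs, abs_of_nonneg (sq_nonneg _)]
    refine (pow_le_pow_left₀ (by linarith [hRL ω]) ?_ 2).trans (hQ4 ω)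
    linarith [hLQ ω, hR0 ω]
  have hoff : ∀ᵐ ω ∂μ, ω ∉ B → G ω ≤ (1 - κ') ^ K * (L ω - R ω) + e / κ' * Q ω := by
    filter_upwards [hcubeAll] with ω hω hωB
    have hclose : UniformlyClose P nδ τ (x ω) := by
      by_contra h
      exact hωB (subset_toMeasurable _ _ h)
    have h : G ω ≤ (1 - κ') ^ K * (L ω - R ω) + e / κ' * L ω :=
      drawMean_treeLoss_sub_le (q := q) hp hq hqp hpick hα₀ hα₁ hl₀ (by linarith) hκ'0
        hκ'1 hκκ he0 (y ω) (fun T hT => wellConditioned_of_reached hη₁ hδ₁ hl₀ hcor hv hvσ hvP hp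
          hτ hτ0.le hτ1 hn1 (fun i => hω i) hclose hT) K
    have h2 : e / κ' * L ω ≤ e / κ' * Q ω :=
      mul_le_mul_of_nonneg_left (hLQ ω) (by positivity)
    linarith
  have hmain := integral_le_of_bound_off hGint hLR2 hQint hQ4int hBm
    (fun ω => sub_nonneg.2 (hRL ω)) hQ0 hQ4 (fun ω => (hG_le ω).trans (hLQ ω))
    (pow_nonneg (by linarith) K) (by positivity) hnδ0 hoff
  rw [hQint_eq, hQ4int_eq] at hmain
  have hzero : (∫ ω, (drawMean fun d : Draw p q 0 =>
      (treeLoss θ pick (x ω) (y ω) 0 d - lsLoss (x ω) (y ω)) ^ 2) ∂μ)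
      = ∫ ω, (L ω - R ω) ^ 2 ∂μ := by
    simp only [treeLoss_zero, drawMean_const hqp]
    rfl
  rw [hzero]
  exact hmain.trans (add_le_add le_rfl (remainder_le hn hδ₁ hM₄0 hD0 hBμ))
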